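/- Let $\mathcal{L\text{-}P}$ be the Laguerre--P\'olya class, i.e. the set of all functions $$f(z)=c\,z^{d}e^{-\gamma z^{2}+\beta z}\prod_{j=1}^{\omega}\Bigl(1-\frac{z}{\alpha_j}\Bigr)e^{z/\alpha_j},\qquad 0\le\omega\le\infty,$$ where $c,\beta\in\mathbb{R}$, $\alpha_j\in\mathbb{R}\setminus\{0\}$, $\gamma\ge 0$, $d$ is a nonnegative integer and $\sum_j\alpha_j^{-2}<\infty$. Let $\mathcal{L\text{-}P^{*}}$ be the set of all functions $\varphi=pf$ with $f\in\mathcal{L\text{-}P}$ and $p$ a real polynomial with no real zeros. \textbf{Theorem (the Hawaii conjecture).} Let $\varphi\in\mathcal{L\text{-}P^{*}}$, and suppose that $\varphi$ is not of the form $\varphi(z)=Ce^{\beta z}$ with $C,\beta\in\mathbb{R}$. Let $Q$ be the meromorphic function $$Q(z)=\frac{d}{dz}\left(\frac{\varphi'(z)}{\varphi(z)}\right)=\frac{\varphi(z)\varphi''(z)-\varphi'(z)^{2}}{\varphi(z)^{2}}.$$ If $\varphi$ has exactly $2m$ nonreal zeros, counting multiplicities, then the number of real zeros of $Q$, counting multiplicities,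 does not exceed $2m$ (in particular, it is finite). -/

import Mathlib

/-- The Laguerre–Pólya class: functions
`c z ^ d exp (-γ z² + β z) ∏_{j < ω} (1 - z / α_j) exp (z / α_j)` with `0 ≤ ω ≤ ∞`, real
`c`, `β`, `α_j ≠ 0`, real `γ ≥ 0`, natural `d`, and `∑ α_j⁻² < ∞`. -/
def IsLaguerrePolya (f : ℂ → ℂ) : Prop :=
  ∃ (c β γ : ℝ) (d : ℕ) (ω : ℕ∞) (α : ℕ → ℝ),
    0 ≤ γ ∧
    (∀ j : ℕ, (j : ℕ∞) < ω → α j ≠ 0) ∧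
    Summable (fun j : {j : ℕ // (j : ℕ∞) < ω} => ((α j) ^ 2)⁻¹) ∧
    ∀ z : ℂ, ∃ P : ℂ,
      HasProd (fun j : {j : ℕ // (j : ℕ∞) < ω} =>
        (1 - z / (α j : ℂ)) * Complex.exp (z / (α j : ℂ))) P ∧
      f z = (c : ℂ) * z ^ d * Complex.exp (-(γ : ℂ) * z ^ 2 + (β : ℂ) * z) * P

/-- The class of products `p f`, with `f` in the Laguerre–Pólya class and `p` a real polynomial
without real zeros. -/
def IsLaguerrePolyaStar (φ : ℂ → ℂ) : Prop :=
  ∃ (p : Polynomial ℝ) (f : ℂ → ℂ),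
    (∀ x : ℝ, p.eval x ≠ 0) ∧ IsLaguerrePolya f ∧
    ∀ z : ℂ, φ z = Polynomial.aeval z p * f z

/-- The function `Q[φ] = (φ' / φ)'`. Its values at the zeros of `φ` (which are poles of `Q[φ]`)
are irrelevant: zeros are counted below by the order of a meromorphic function, which does not
depend on the value at the point itself. -/
noncomputable def hawaiiQ (φ : ℂ → ℂ) : ℂ → ℂ :=
  deriv (fun z => deriv φ z / φ z)

/-- The multiplicity of `z` as a zero of a meromorphic function `f`: the order of `f` at `z` if
that is nonnegative, `0` if `z` is a pole, and `∞` if `f` vanishes identically near `z`. -/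
noncomputable def zeroMultiplicity (f : ℂ → ℂ) (z : ℂ) : ℕ∞ :=
  WithTop.map Int.toNat (meromorphicOrderAt f z)

/-- The number of zeros of a meromorphic function `f` in `X`, counting multiplicities: the sum of
the multiplicities over `X`, that is, the supremum of its finite partial sums. -/
noncomputable def zeroCount (f : ℂ → ℂ) (X : Set ℂ) : ℕ∞ :=
  ⨆ F : {F : Finset ℂ // (F : Set ℂ) ⊆ X}, ∑ z ∈ F.1, zeroMultiplicity f z

/-! Write L[φ] = φφ'' - φ'², so that Q = L[φ]/φ², and let g = φ' - tφ. Then L[φ] is the Wronskian of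
φ and g, and (e^{-tx} L[φ]/g)' = e^{-tx} φ L[g]/g². Through Rolle's theorem this identity produces
real zeros of (g'/g)' from real zeros of Q.

For a polynomial p, let t = M be the largest value of p'/p at a real zero of (p'/p)', and suppose M
> 0; a reflection x ↦ -x and a separate treatment of the case where all these values vanish cover
the rest. By Rolle applied to e^{-Mx}p, each distinct real zero of p is followed by its own zero of
g, so g has at most as many nonreal zeros as p. A point where M is attained is a multiple zero of g,
so g has strictly fewer. Between consecutive zeros of (p'/p)' Rolle finds a zero of (g'/g)'; the
hard case, a zero of p in between, is `exists_laguerre_shiftDeriv_eq_zero_of_isNextShiftRoot`. The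
count is `card_laguerreZeros_sdiff_le`, and induction on the number of nonreal zeros bounds the
number of distinct real zeros of (p'/p)'.

Real zeros may leave the axis under perturbation, but sign changes persist. If L[r] has a zero of
order k at x and r(x) ≠ 0, then for large t the function L[r' - tr] has order k - 1 at x and changes
sign just to the right of x. Iteration turns zeros counted with multiplicity into sign changes on
disjoint intervals. These survive when φ = pf is approximated locally uniformly by polynomials pq
with q real-rooted. As D - t does not increase the number of nonreal zeros, the polynomial bound
gives at most deg p ≤ 2m sign changes. -/

open Polynomial Set Filter Topology

/-! ### Rolle's theorem and signs on intervals -/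

/-- A variant of Rolle's theorem on a half-line. -/
theorem exists_hasDerivAt_eq_zero_of_tendsto_atTop {F F' : ℝ → ℝ} {u : ℝ}
    (hc : ContinuousOn F (Ici u)) (hu : F u = 0) (hlim : Tendsto F atTop (𝓝 0))
    (hd : ∀ x ∈ Ioi u, HasDerivAt F (F' x) x) : ∃ c ∈ Ioi u, F' c = 0 := by
  have key : ∀ G G' : ℝ → ℝ, ContinuousOn G (Ici u) → G u = 0 → Tendsto G atTop (𝓝 0) →
      (∀ x ∈ Ioi u, HasDerivAt G (G' x) x) → (∃ x ∈ Ioi u, 0 < G x) → ∃ c ∈ Ioi u, G' c = 0 := by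
    rintro G G' hc hu hlim hd ⟨x, hx, hGx⟩
    obtain ⟨y, hy1, hy2⟩ := ((hlim.eventually_lt_const hGx).and (eventually_gt_atTop x)).exists
    have hxu : u < x := hx
    obtain ⟨c, hcm, hcmax⟩ := isCompact_Icc.exists_isMaxOn (s := Icc u y)
      ⟨x, hxu.le, hy2.le⟩ (hc.mono Icc_subset_Ici_self)
    have hxc : G x ≤ G c := hcmax ⟨hxu.le, hy2.le⟩
    have h1 : u < c := lt_of_le_of_ne hcm.1 (by rintro rfl; linarith)
    have h2 : c < y := lt_of_le_of_ne hcm.2 (by rintro rfl; linarith)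
    exact ⟨c, h1, (hcmax.isLocalMax (Icc_mem_nhds h1 h2)).hasDerivAt_eq_zero (hd c h1)⟩
  by_cases hpos : ∃ x ∈ Ioi u, 0 < F x
  · exact key F F' hc hu hlim hd hpos
  by_cases hneg : ∃ x ∈ Ioi u, F x < 0
  · obtain ⟨c, hc1, hc2⟩ := key (fun x => -F x) (fun x => -F' x) hc.neg (by simp [hu])
      (by simpa using hlim.neg) (fun x hx => (hd x hx).neg) (by simpa using hneg)
    exact ⟨c, hc1, by simpa using hc2⟩
  push Not at hpos hneg
  have h0 : ∀ x ∈ Ioi u, F x = 0 := fun x hx => le_antisymm (hpos x hx) (hneg x hx)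
  refine ⟨u + 1, by simp, ?_⟩
  have hu1 : u + 1 ∈ Ioi u := by simp
  refine (hd (u + 1) hu1).unique ((hasDerivAt_const (u + 1) (0 : ℝ)).congr_of_eventuallyEq ?_)
  filter_upwards [Ioi_mem_nhds hu1] with x hx using h0 x hx

/-- A continuous function without zeros on an interval has constant sign there. -/
theorem mul_pos_of_ne_zero_of_ordConnected {h : ℝ → ℝ} {s : Set ℝ} (hs : s.OrdConnected)
    (hc : ContinuousOn h s) (h0 : ∀ x ∈ s, h x ≠ 0) {x y : ℝ} (hx : x ∈ s) (hy : y ∈ s) :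
    0 < h x * h y := by
  by_contra hneg
  have hsub : uIcc x y ⊆ s := hs.uIcc_subset hx hy
  have : (0 : ℝ) ∈ uIcc (h x) (h y) := by
    rw [mem_uIcc]
    by_contra hcon
    push Not at hcon
    rcases lt_or_gt_of_ne (h0 x hx) with h1 | h1 <;> rcases lt_or_gt_of_ne (h0 y hy) with h2 | h2
    · nlinarith
    · linarith [hcon.1 h1.le]
    · linarith [hcon.2 h2.le]
    · nlinarith [mul_pos h1 h2]
  obtain ⟨c, hcm, hc0⟩ := intermediate_value_uIcc (hc.mono hsub) this
  exact h0 c (hsub hcm) hc0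

theorem exists_hasDerivAt_eq_mul_sub {F F' : ℝ → ℝ} {a b : ℝ} (hab : a < b)
    (hc : ContinuousOn F (Icc a b)) (hd : ∀ x ∈ Ioo a b, HasDerivAt F (F' x) x) :
    ∃ c ∈ Ioo a b, F b - F a = F' c * (b - a) := by
  obtain ⟨c, hcm, hc⟩ := exists_hasDerivAt_eq_slope F F' hab hc hd
  refine ⟨c, hcm, ?_⟩
  rw [hc, div_mul_cancel₀ _ (sub_ne_zero.2 hab.ne')]

/-! ### Polynomials: the Laguerre expression and the operator D - t -/

/-- The numerator `p p'' - p' ^ 2` of the derivative of the logarithmic derivative `p' / p`. -/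
noncomputable def Polynomial.laguerre (p : ℝ[X]) : ℝ[X] :=
  p * derivative (derivative p) - derivative p ^ 2

/-- The operator `D - t` applied to a polynomial. -/
noncomputable def Polynomial.shiftDeriv (t : ℝ) (p : ℝ[X]) : ℝ[X] := derivative p - C t * p

namespace Polynomial

/-- The Wronskian of p and p' does not change when a multiple of p is subtracted from p'. -/
theorem eval_laguerre_eq_shiftDeriv (p : ℝ[X]) (t x : ℝ) : p.laguerre.eval x =
    p.eval x * (derivative (shiftDeriv t p)).eval x
      - (derivative p).eval x * (shiftDeriv t p).eval x := by
  simp [laguerre, shiftDeriv]; ring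

theorem natDegree_shiftDeriv {p : ℝ[X]} {t : ℝ} (ht : t ≠ 0) :
    (shiftDeriv t p).natDegree = p.natDegree := by
  rcases Nat.eq_zero_or_pos p.natDegree with h | h
  · rw [eq_C_of_natDegree_eq_zero h, shiftDeriv, derivative_C, zero_sub, ← C_mul, ← C_neg,
      natDegree_C, natDegree_C]
  have h1 : (C t * p).natDegree = p.natDegree := natDegree_C_mul ht
  rw [shiftDeriv, natDegree_sub_eq_right_of_natDegree_lt, h1]
  rw [h1]
  exact natDegree_derivative_lt h.ne'

theorem shiftDeriv_ne_zero {p : ℝ[X]} {t : ℝ} (ht : t ≠ 0) (hp : p ≠ 0) :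
    shiftDeriv t p ≠ 0 := by
  intro h
  rcases Nat.eq_zero_or_pos p.natDegree with h' | h'
  · rw [eq_C_of_natDegree_eq_zero h'] at h hp
    simp [shiftDeriv, ht] at h
    rw [h] at hp; simp at hp
  · have := natDegree_shiftDeriv (p := p) ht
    rw [h] at this; simp at this; omega

/-- With d the degree and a the leading coefficient, the coefficient of x^(2d-2) is a²d(d-1) - a²d²
= -a²d. -/
theorem laguerre_ne_zero {p : ℝ[X]} (hp : 1 ≤ p.natDegree) : p.laguerre ≠ 0 := by
  intro h
  have hp0 : p ≠ 0 := by rintro rfl; simp at hp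
  have h1 := congrArg (fun q => q.coeff (2 * p.natDegree - 2)) h
  obtain ⟨n, hn⟩ : ∃ n, p.natDegree = n + 1 := ⟨p.natDegree - 1, by omega⟩
  have hd : (derivative p).natDegree ≤ n := by
    have := natDegree_derivative_le p; omega
  have e2 : (derivative p ^ 2).coeff (n + n) = (p.leadingCoeff * (n + 1)) ^ 2 := by
    rw [sq, coeff_mul_add_eq_of_natDegree_le hd hd, coeff_derivative, leadingCoeff, hn]; ring
  have e1 : (p * derivative (derivative p)).coeff (n + n)
      = p.leadingCoeff * (p.leadingCoeff * (n + 1) * n) := by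
    rcases n with _ | n
    · have : derivative (derivative p) = 0 := by
        rw [eq_C_of_natDegree_le_zero hd]; simp
      simp [this]
    · have hdd : (derivative (derivative p)).natDegree ≤ n := by
        have := natDegree_derivative_le (derivative p); omega
      have : n + 1 + (n + 1) = (n + 1 + 1) + n := by ring
      rw [this, coeff_mul_add_eq_of_natDegree_le hn.le hdd, coeff_derivative, coeff_derivative,
        leadingCoeff, hn]
      push_cast; ring
  have : 2 * p.natDegree - 2 = n + n := by omega
  simp only [laguerre, coeff_sub, this, e1, e2, coeff_zero] at h1
  have hl : p.leadingCoeff ≠ 0 := leadingCoeff_ne_zero.2 hp0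
  have h2 : p.leadingCoeff ^ 2 * ((n : ℝ) + 1) = 0 := by linear_combination -h1
  have h3 : (n : ℝ) + 1 ≠ 0 := by positivity
  exact (mul_ne_zero (pow_ne_zero 2 hl) h3) h2

theorem hasDerivAt_exp_mul_eval (p : ℝ[X]) (M x : ℝ) :
    HasDerivAt (fun x => Real.exp (-M * x) * p.eval x)
      (Real.exp (-M * x) * (shiftDeriv M p).eval x) x := by
  have h1 : HasDerivAt (fun x : ℝ => Real.exp (-M * x)) (Real.exp (-M * x) * (-M)) x := by
    simpa using ((hasDerivAt_id x).const_mul (-M)).exp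
  refine (h1.mul (p.hasDerivAt x)).congr_deriv ?_
  simp [shiftDeriv]; ring

/-- The identity behind every Rolle argument below: away from zeros of p and g = p' - Mp, critical
points of this function are zeros of (g'/g)'. -/
theorem hasDerivAt_exp_mul_laguerre_div (p : ℝ[X]) (M : ℝ) {x : ℝ}
    (hx : (shiftDeriv M p).eval x ≠ 0) :
    HasDerivAt (fun x => Real.exp (-M * x) * p.laguerre.eval x / (shiftDeriv M p).eval x)
      (Real.exp (-M * x) * p.eval x * (shiftDeriv M p).laguerre.eval x
        / (shiftDeriv M p).eval x ^ 2) x := by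
  refine ((hasDerivAt_exp_mul_eval p.laguerre M x).div
    ((shiftDeriv M p).hasDerivAt x) hx).congr_deriv ?_
  congr 1
  simp [laguerre, shiftDeriv, derivative_sq]; ring

theorem tendsto_exp_mul_eval_div {M : ℝ} (hM : 0 < M) (q : ℝ[X]) {r : ℝ[X]} (hr : r ≠ 0) :
    Tendsto (fun x => Real.exp (-M * x) * q.eval x / r.eval x) atTop (𝓝 0) := by
  have h1 : Tendsto (fun x => Real.exp (-M * x) * q.eval x) atTop (𝓝 0) := by
    have := (tendsto_div_exp_atTop (q.comp (C M⁻¹ * X))).comp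
      ((tendsto_id (α := ℝ)).const_mul_atTop hM)
    refine this.congr fun x => ?_
    simp only [Function.comp, id, eval_comp, eval_mul, eval_C, eval_X]
    rw [inv_mul_cancel_left₀ hM.ne', neg_mul, Real.exp_neg]
    field_simp
  have h2 : (fun _ => (1 : ℝ)) =O[atTop] (fun x => r.eval x) := by
    have := isBigO_atTop_of_degree_le (1 : ℝ[X]) r (by rw [degree_one]; exact zero_le_degree_iff.2 hr)
    simpa using this
  have hr0 : ∀ᶠ x in atTop, r.eval x ≠ 0 := by
    filter_upwards [h2.eq_zero_imp] with x hx h using one_ne_zero (hx h)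
  have h3 : (fun x => (r.eval x)⁻¹) =O[atTop] (fun _ => (1 : ℝ)) := by
    simpa using h2.inv_rev (by simp)
  have := h3.mul (Asymptotics.isBigO_refl (fun x => Real.exp (-M * x) * q.eval x) atTop)
  refine (this.trans_tendsto (by simpa using h1)).congr fun x => ?_
  rw [div_eq_mul_inv, mul_comm]

/-- At a zero of order k, p behaves like (x - a)^k and p' - Mp like k(x - a)^(k-1), up to a common
constant. Used where a is also a zero of p' - Mp. -/
theorem tendsto_eval_div_shiftDeriv {p : ℝ[X]} (hp : p ≠ 0) (M : ℝ) {a : ℝ} (ha : p.eval a = 0) :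
    Tendsto (fun x => p.eval x / (shiftDeriv M p).eval x) (𝓝[≠] a) (𝓝 0) := by
  obtain ⟨r, hr, hnd⟩ := exists_eq_pow_rootMultiplicity_mul_and_not_dvd p hp a
  obtain ⟨j, hj⟩ : ∃ j, p.rootMultiplicity a = j + 1 :=
    Nat.exists_eq_succ_of_ne_zero ((rootMultiplicity_pos hp).2 ha).ne'
  rw [hj] at hr
  have hra : r.eval a ≠ 0 := fun h => hnd (dvd_iff_isRoot.2 h)
  set s : ℝ[X] := C ((j : ℝ) + 1) * r + (X - C a) * (derivative r - C M * r) with hs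
  have hg : shiftDeriv M p = (X - C a) ^ j * s := by
    rw [shiftDeriv, hr, derivative_mul, derivative_X_sub_C_pow, hs]
    simp; ring
  have hsa : s.eval a ≠ 0 := by
    simp [hs, hra]; positivity
  have hlim : Tendsto (fun x => (x - a) * r.eval x / s.eval x) (𝓝[≠] a) (𝓝 0) := by
    have : ContinuousAt (fun x => (x - a) * r.eval x / s.eval x) a :=
      ((continuousAt_id.sub continuousAt_const).mul r.continuousAt).div s.continuousAt hsa
    have h2 := this.tendsto.mono_left (nhdsWithin_le_nhds (s := {a}ᶜ))
    simpa using h2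
  refine hlim.congr' ?_
  filter_upwards [self_mem_nhdsWithin] with x hx
  have hxa : x - a ≠ 0 := sub_ne_zero.2 hx
  rw [hg, hr]
  simp only [eval_mul, eval_pow, eval_sub, eval_X, eval_C]
  rw [pow_succ, mul_assoc, mul_div_mul_left _ _ (pow_ne_zero j hxa)]

/-! ### The first zero of p' - Mp after a zero of p -/

/-- `b` is the first zero of `p' - M p` to the right of the zero `a` of `p`, and `p` has no zero
in between. -/
structure IsNextShiftRoot (M : ℝ) (p : ℝ[X]) (a b : ℝ) : Prop where
  lt : a < b
  left : p.eval a = 0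
  right : (shiftDeriv M p).eval b = 0
  ne_zero : ∀ x ∈ Ioc a b, p.eval x ≠ 0
  shift_ne_zero : ∀ x ∈ Ioo a b, (shiftDeriv M p).eval x ≠ 0

/-- Rolle for e^{-Mx}p, whose derivative is e^{-Mx}(p' - Mp), on the interval up to the next zero of
p, or on the half-line if there is none, where M > 0 gives decay at infinity. -/
theorem exists_isNextShiftRoot {M : ℝ} (hM : 0 < M) {p : ℝ[X]} (hp : p ≠ 0) {a : ℝ}
    (ha : p.eval a = 0) : ∃ b, IsNextShiftRoot M p a b := by
  have hg : shiftDeriv M p ≠ 0 := shiftDeriv_ne_zero hM.ne' hp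
  have hf0 : ∀ x, p.eval x = 0 → Real.exp (-M * x) * p.eval x = 0 := fun x hx => by simp [hx]
  have hfc : Continuous (fun x => Real.exp (-M * x) * p.eval x) :=
    continuous_iff_continuousAt.2 fun x => (hasDerivAt_exp_mul_eval p M x).continuousAt
  obtain ⟨b, hab, hb0, hb⟩ : ∃ b > a, (shiftDeriv M p).eval b = 0 ∧
      ∀ x ∈ Ioc a b, p.eval x ≠ 0 := by
    by_cases h : ((p.roots.toFinset).filter (fun x => a < x)).Nonempty
    · set c := Finset.min' _ h
      have hc : c ∈ (p.roots.toFinset).filter (fun x => a < x) := Finset.min'_mem _ h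
      have hcm : ∀ x, a < x → p.eval x = 0 → c ≤ x := fun x h1 h2 =>
        Finset.min'_le _ _ (by simp [hp, h1, h2])
      simp only [Finset.mem_filter, Multiset.mem_toFinset, mem_roots hp, IsRoot.def] at hc
      obtain ⟨b, hb1, hb2⟩ := exists_hasDerivAt_eq_zero hc.2 hfc.continuousOn
        ((hf0 a ha).trans (hf0 c hc.1).symm) (fun x _ => hasDerivAt_exp_mul_eval p M x)
      refine ⟨b, hb1.1, by simpa [Real.exp_ne_zero] using hb2, fun x hx h0 => ?_⟩
      linarith [hcm x hx.1 h0, hx.2, hb1.2]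
    · obtain ⟨b, hb1, hb2⟩ := exists_hasDerivAt_eq_zero_of_tendsto_atTop (u := a)
        hfc.continuousOn (hf0 a ha)
        (by simpa using tendsto_exp_mul_eval_div hM p (one_ne_zero (α := ℝ[X])))
        (fun x _ => hasDerivAt_exp_mul_eval p M x)
      refine ⟨b, hb1, by simpa [Real.exp_ne_zero] using hb2, fun x hx h0 => h ⟨x, ?_⟩⟩
      simp [hp, h0, hx.1]
  have hne : (((shiftDeriv M p).roots.toFinset).filter (fun x => a < x)).Nonempty :=
    ⟨b, by simp [hg, hb0, hab]⟩
  set c := Finset.min' _ hne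
  have hc : c ∈ ((shiftDeriv M p).roots.toFinset).filter (fun x => a < x) :=
    Finset.min'_mem _ hne
  have hcm : ∀ x, a < x → (shiftDeriv M p).eval x = 0 → c ≤ x := fun x h1 h2 =>
    Finset.min'_le _ _ (by simp [hg, h1, h2])
  simp only [Finset.mem_filter, Multiset.mem_toFinset, mem_roots hg, IsRoot.def] at hc
  exact ⟨c, hc.2, ha, hc.1, fun x hx => hb x ⟨hx.1, hx.2.trans (hcm b hab hb0)⟩,
    fun x hx h0 => (hcm x hx.1 h0).not_gt hx.2⟩

/-- e^{-Mx}p starts from 0 at a and its derivative keeps one sign. In other words, p'/p > M on (a,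
b). -/
theorem IsNextShiftRoot.mul_pos {M : ℝ} {p : ℝ[X]} {a b x : ℝ} (h : IsNextShiftRoot M p a b)
    (hx : x ∈ Ioo a b) : 0 < p.eval x * (shiftDeriv M p).eval x := by
  obtain ⟨c, hc, he⟩ := exists_hasDerivAt_eq_mul_sub hx.1 (F := fun x => Real.exp (-M * x) * p.eval x)
    (fun y _ => (hasDerivAt_exp_mul_eval p M y).continuousAt.continuousWithinAt)
    (fun y _ => hasDerivAt_exp_mul_eval p M y)
  have hs := mul_pos_of_ne_zero_of_ordConnected (s := Ioo a b) ordConnected_Ioo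
    (shiftDeriv M p).continuousOn h.shift_ne_zero (x := c) ⟨hc.1, hc.2.trans hx.2⟩ hx
  simp only [h.left, mul_zero, sub_zero] at he
  have e1 : 0 < Real.exp (-M * x) := Real.exp_pos _
  have e2 : 0 < Real.exp (-M * c) := Real.exp_pos _
  have e3 : 0 < x - a := sub_pos.2 hx.1
  have : 0 < Real.exp (-M * x) * (p.eval x * (shiftDeriv M p).eval x) := by
    rw [← mul_assoc, he]
    have := _root_.mul_pos (_root_.mul_pos e2 e3) hs
    linarith
  exact pos_of_mul_pos_right this e1.le

/-- A logarithmic derivative of a function vanishing at the right end of an interval is not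
bounded below there. -/
theorem false_of_le_deriv_div {G m : ℝ → ℝ} {G' : ℝ → ℝ} {a b : ℝ} (hab : a < b)
    (hG : ∀ x ∈ Icc a b, HasDerivAt G (G' x) x) (hb : G b = 0) (hpos : ∀ x ∈ Ico a b, 0 < G x)
    (hm : ContinuousOn m (Icc a b)) (hle : ∀ x ∈ Ico a b, m x * G x ≤ G' x) : False := by
  -- With K the minimum of m, G e^{-Kx} has nonnegative derivative, yet it falls from a positive
  -- value to 0.
  obtain ⟨c, -, hc⟩ := isCompact_Icc.exists_isMinOn (nonempty_Icc.2 hab.le) hm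
  set K := m c
  have hd : ∀ x ∈ Icc a b, HasDerivAt (fun x => G x * Real.exp (-K * x))
      ((G' x - K * G x) * Real.exp (-K * x)) x := by
    intro x hx
    have h1 : HasDerivAt (fun x : ℝ => Real.exp (-K * x)) (Real.exp (-K * x) * (-K)) x := by
      simpa using ((hasDerivAt_id x).const_mul (-K)).exp
    exact ((hG x hx).mul h1).congr_deriv (by ring)
  obtain ⟨d, hdm, he⟩ := exists_hasDerivAt_eq_mul_sub hab
    (fun y hy => (hd y hy).continuousAt.continuousWithinAt) (fun y hy => hd y (Ioo_subset_Icc_self hy))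
  have h1 : 0 ≤ G' d - K * G d := by
    have h2 : K ≤ m d := hc (Ioo_subset_Icc_self hdm)
    nlinarith [hle d ⟨hdm.1.le, hdm.2⟩, hpos d ⟨hdm.1.le, hdm.2⟩]
  have h3 := hpos a ⟨le_rfl, hab⟩
  have h4 : 0 < G a * Real.exp (-K * a) := by positivity
  have h5 : 0 ≤ (G' d - K * G d) * Real.exp (-K * d) * (b - a) :=
    mul_nonneg (mul_nonneg h1 (Real.exp_pos _).le) (sub_pos.2 hab).le
  simp only [hb, zero_mul, zero_sub] at he
  linarith

/-- Between a zero `u` of `(p' / p)'` and the first zero of `p' - M p` to the right of the next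
zero `a` of `p`, the function `(g' / g)'` with `g = p' - M p` has a zero. -/
theorem exists_laguerre_shiftDeriv_eq_zero_of_isNextShiftRoot {M : ℝ} {p : ℝ[X]} {u a b : ℝ}
    (hp : p ≠ 0) (hu : p.laguerre.eval u = 0) (hua : u < a) (hpu : ∀ x ∈ Ico u a, p.eval x ≠ 0)
    (hg : ∀ x ∈ Ico u a, (shiftDeriv M p).eval x ≠ 0) (hab : IsNextShiftRoot M p a b) :
    ∃ c ∈ Ioo u b, (shiftDeriv M p).laguerre.eval c = 0 ∧ (shiftDeriv M p).eval c ≠ 0 := by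
  by_contra hcon
  push Not at hcon
  set g := shiftDeriv M p with hgdef
  have hW1 : ∀ c ∈ Ioo u b, g.eval c ≠ 0 → g.laguerre.eval c ≠ 0 :=
    fun c hc h1 h2 => h1 (hcon c hc h2)
  set F : ℝ → ℝ := fun x => Real.exp (-M * x) * p.laguerre.eval x / g.eval x with hF
  have hFd := fun x (hx : g.eval x ≠ 0) => hasDerivAt_exp_mul_laguerre_div p M hx
  have hFu : F u = 0 := by simp [hF, hu]
  have hga : g.eval a = (derivative p).eval a := by simp [hgdef, shiftDeriv, hab.left]
  have hub : u < b := hua.trans hab.lt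
  -- Multiple zero of p at a: F tends to 0 there, so Rolle on (u, a) suffices.
  by_cases hs : (derivative p).eval a = 0
  · have hlim : Tendsto F (𝓝[<] a) (𝓝 0) := by
      have h1 : Tendsto (fun x => Real.exp (-M * x) * (p.eval x / g.eval x * (derivative g).eval x
          - (derivative p).eval x)) (𝓝[<] a) (𝓝 (Real.exp (-M * a) *
            (0 * (derivative g).eval a - (derivative p).eval a))) := by
        refine Tendsto.mul ?_ (Tendsto.sub (Tendsto.mul ?_ ?_) ?_)
        · exact (by fun_prop : Continuous fun x : ℝ => Real.exp (-M * x)).continuousAt.tendsto.mono_left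
            nhdsWithin_le_nhds
        · exact (tendsto_eval_div_shiftDeriv hp M hab.left).mono_left
            (nhdsWithin_mono _ fun x hx => (ne_of_lt hx : x ≠ a))
        · exact (derivative g).continuousAt.tendsto.mono_left nhdsWithin_le_nhds
        · exact (derivative p).continuousAt.tendsto.mono_left nhdsWithin_le_nhds
      simp only [hs, zero_mul, sub_zero, mul_zero] at h1
      refine h1.congr' ?_
      filter_upwards [Ioo_mem_nhdsLT hua] with x hx
      have := hg x ⟨hx.1.le, hx.2⟩
      simp only [hF, eval_laguerre_eq_shiftDeriv p M x, ← hgdef]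
      field_simp
    have hgu := hg u ⟨le_rfl, hua⟩
    obtain ⟨c, hc, h0⟩ := exists_hasDerivAt_eq_zero' hua
      (((hFd u hgu).continuousAt.tendsto.mono_left nhdsWithin_le_nhds).trans_eq (by rw [← hFu]))
      hlim (fun x hx => hFd x (hg x ⟨hx.1.le, hx.2⟩))
    have h1 := hg c ⟨hc.1.le, hc.2⟩
    have h2 := hW1 c ⟨hc.1, hc.2.trans hab.lt⟩ h1
    have h3 := hpu c ⟨hc.1.le, hc.2⟩
    exact div_ne_zero (mul_ne_zero (mul_ne_zero (Real.exp_ne_zero _) h3) h2)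
      (pow_ne_zero 2 h1) h0
  -- Simple zero: g(a) = s ≠ 0, and gs > 0 on [u, b). Since F(u) = 0 and sF(a) < 0, while ps < 0 on
  -- the left of a, the mean value theorem forces L[g] > 0 at some c, hence on all of (u, b).
  · set s := (derivative p).eval a with hsdef
    have hg0 : ∀ x ∈ Ico u b, g.eval x ≠ 0 := by
      intro x hx
      rcases lt_trichotomy x a with h | h | h
      · exact hg x ⟨hx.1, h⟩
      · rw [h, hga]; exact hs
      · exact hab.shift_ne_zero x ⟨h, hx.2⟩
    have hgs : ∀ x ∈ Ico u b, 0 < g.eval x * s := fun x hx => by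
      rw [← hga]
      exact mul_pos_of_ne_zero_of_ordConnected ordConnected_Ico g.continuousOn hg0 hx
        ⟨hua.le, hab.lt⟩
    have hs2 : 0 < s * s := mul_self_pos.2 hs
    have hFa : F a = -(Real.exp (-M * a) * s) := by
      simp only [hF, eval_laguerre_eq_shiftDeriv p M a, ← hgdef, hab.left, hga, ← hsdef]
      field_simp; ring
    have hFc : ∀ x ∈ Ico u b, ContinuousAt F x := fun x hx => (hFd x (hg0 x hx)).continuousAt
    obtain ⟨c, hc, hce⟩ := exists_hasDerivAt_eq_mul_sub hua
      (fun x hx => (hFc x ⟨hx.1, hx.2.trans_lt hab.lt⟩).continuousWithinAt)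
      (fun x hx => hFd x (hg0 x ⟨hx.1.le, hx.2.trans hab.lt⟩))
    have hcI : c ∈ Ico u b := ⟨hc.1.le, hc.2.trans hab.lt⟩
    have hpc : p.eval c * s < 0 := by
      obtain ⟨d, hd, hde⟩ := exists_hasDerivAt_eq_mul_sub hc.2
        (F := fun x => Real.exp (-M * x) * p.eval x)
        (fun y _ => (hasDerivAt_exp_mul_eval p M y).continuousAt.continuousWithinAt)
        (fun y _ => hasDerivAt_exp_mul_eval p M y)
      have h1 := hgs d ⟨hc.1.le.trans hd.1.le, hd.2.trans hab.lt⟩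
      simp only [hab.left, mul_zero, zero_sub] at hde
      have h2 : 0 < Real.exp (-M * d) * (g.eval d * s) * (a - c) :=
        mul_pos (mul_pos (Real.exp_pos _) h1) (sub_pos.2 hc.2)
      have h3 : Real.exp (-M * c) * -(p.eval c * s) =
          Real.exp (-M * d) * (g.eval d * s) * (a - c) := by
        linear_combination s * hde
      have := pos_of_mul_pos_right (h3 ▸ h2) (Real.exp_pos (-M * c)).le
      linarith
    have hWc : 0 < g.laguerre.eval c := by
      rw [hFa, hFu] at hce
      have hg2 : 0 < g.eval c ^ 2 := by have := hg0 c hcI; positivity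
      have h3 : Real.exp (-M * a) * (s * s) =
          Real.exp (-M * c) * -(p.eval c * s) / g.eval c ^ 2 * (a - u) * g.laguerre.eval c := by
        linear_combination -s * hce
      have h4 : 0 < Real.exp (-M * c) * -(p.eval c * s) / g.eval c ^ 2 * (a - u) := by
        have := neg_pos.2 hpc
        have := sub_pos.2 hua
        positivity
      have h5 : 0 < Real.exp (-M * a) * (s * s) := by positivity
      exact pos_of_mul_pos_right (h3 ▸ h5) h4.le
    have hWpos : ∀ x ∈ Ioo u b, 0 < g.laguerre.eval x := fun x hx => by
      have := mul_pos_of_ne_zero_of_ordConnected (s := Ioo u b) ordConnected_Ioo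
        g.laguerre.continuousOn (fun y hy => hW1 y hy (hg0 y ⟨hy.1.le, hy.2⟩))
        (x := c) ⟨hc.1, hcI.2⟩ hx
      exact pos_of_mul_pos_right this hWc.le
    have hps : ∀ x ∈ Ioo a b, 0 < p.eval x * s := fun x hx => by
      have h1 := hab.mul_pos hx
      have h2 := hgs x ⟨hua.le.trans hx.1.le, hx.2⟩
      have h3 : 0 < (g.eval x ^ 2) * (p.eval x * s) := by
        have := mul_pos h1 h2
        rw [← hgdef] at this
        linarith
      exact pos_of_mul_pos_right h3 (sq_nonneg _)
    -- Right of a, ps > 0, so sF increases and stays above sF(a).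
    have hFmono : ∀ x ∈ Ioo a b, s * F a ≤ s * F x := by
      intro x hx
      obtain ⟨d, hd, hde⟩ := exists_hasDerivAt_eq_mul_sub hx.1
        (fun y hy => (hFc y ⟨hua.le.trans hy.1, hy.2.trans_lt hx.2⟩).continuousWithinAt)
        (fun y hy => hFd y (hg0 y ⟨hua.le.trans hy.1.le, hy.2.trans hx.2⟩))
      have h1 := hps d ⟨hd.1, hd.2.trans hx.2⟩
      have h2 := hWpos d ⟨hua.trans hd.1, hd.2.trans hx.2⟩
      have h3 : 0 ≤ Real.exp (-M * d) * (p.eval d * s) * g.laguerre.eval d / g.eval d ^ 2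
          * (x - a) := by
        have := sub_pos.2 hx.1
        positivity
      have h4 : s * (F x - F a) = Real.exp (-M * d) * (p.eval d * s) * g.laguerre.eval d
          / g.eval d ^ 2 * (x - a) := by
        linear_combination s * hde
      linarith
    -- As F = e^{-Mx}(pg' - p'g)/g and p(b) ≠ 0, the lower bound on sF bounds g'/g from below by a
    -- function continuous up to b. This is impossible because g(b) = 0.
    obtain ⟨x₁, hx₁⟩ := exists_between hab.lt
    have hIoo : ∀ x ∈ Ico x₁ b, x ∈ Ioo a b := fun x hx => ⟨hx₁.1.trans_le hx.1, hx.2⟩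
    refine false_of_le_deriv_div hx₁.2 (G := fun x => s * g.eval x)
      (G' := fun x => s * (derivative g).eval x)
      (m := fun x => (s * (derivative p).eval x - Real.exp (-M * a) * (s * s) * Real.exp (M * x))
        / (s * p.eval x)) (fun x _ => (g.hasDerivAt x).const_mul s) ?_ ?_ ?_ ?_
    · simp only [hgdef, hab.right, mul_zero]
    · intro x hx
      have := hgs x ⟨hua.le.trans (hIoo x hx).1.le, hx.2⟩
      linarith
    · refine ContinuousOn.div (by fun_prop) (by fun_prop) fun x hx => mul_ne_zero hs
        (hab.ne_zero x ⟨hx₁.1.trans_le hx.1, hx.2⟩)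
    · intro x hx
      have h1 := hFmono x (hIoo x hx)
      have h2 := hps x (hIoo x hx)
      have h3 := hgs x ⟨hua.le.trans (hIoo x hx).1.le, hx.2⟩
      have hgx := hg0 x ⟨hua.le.trans (hIoo x hx).1.le, hx.2⟩
      have h4 : s * F x * (Real.exp (M * x) * (g.eval x * s)) =
          (s * s) * (p.eval x * (derivative g).eval x - (derivative p).eval x * g.eval x) := by
        have : Real.exp (-M * x) * Real.exp (M * x) = 1 := by
          rw [← Real.exp_add]; simp
        rw [neg_mul] at this
        simp only [hF, eval_laguerre_eq_shiftDeriv p M x, ← hgdef]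
        field_simp
        linear_combination (p.eval x * (derivative g).eval x
          - (derivative p).eval x * g.eval x) * this
      have h5 := mul_le_mul_of_nonneg_right h1 (mul_pos (Real.exp_pos (M * x)) h3).le
      rw [h4, hFa] at h5
      rw [div_mul_eq_mul_div, div_le_iff₀ (by linarith)]
      linarith

/-! ### Counting zeros for polynomials -/

/-- The real zeros of `(p' / p)'`, without multiplicities. -/
noncomputable def laguerreZeros (p : ℝ[X]) : Finset ℝ :=
  p.laguerre.roots.toFinset \ p.roots.toFinset

theorem mem_laguerreZeros {p : ℝ[X]} (hp : 1 ≤ p.natDegree) {x : ℝ} :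
    x ∈ laguerreZeros p ↔ p.laguerre.eval x = 0 ∧ p.eval x ≠ 0 := by
  have hp0 : p ≠ 0 := by rintro rfl; simp at hp
  simp [laguerreZeros, laguerre_ne_zero hp, hp0]

/-- The zeros of `p' - M p` that are not zeros of `p`, without multiplicities. -/
noncomputable def newShiftRoots (M : ℝ) (p : ℝ[X]) : Finset ℝ :=
  (shiftDeriv M p).roots.toFinset \ p.roots.toFinset

theorem mem_newShiftRoots {M : ℝ} {p : ℝ[X]} (hp : p ≠ 0) (hg : shiftDeriv M p ≠ 0) {x : ℝ} :
    x ∈ newShiftRoots M p ↔ (shiftDeriv M p).eval x = 0 ∧ p.eval x ≠ 0 := by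
  simp [newShiftRoots, hg, hp]

/-- A zero of p of order k is a zero of g = p' - Mp of order at least k - 1. A zero of g off the
zeros of p counts at least once, and twice if L[p] = pg' - p'g also vanishes there, since then g' =
0. -/
theorem card_roots_add_card_newShiftRoots_le {M : ℝ} {p : ℝ[X]} (hp : 1 ≤ p.natDegree)
    (hg : shiftDeriv M p ≠ 0) :
    Multiset.card p.roots + (newShiftRoots M p).card
        + (newShiftRoots M p ∩ laguerreZeros p).card
      ≤ Multiset.card (shiftDeriv M p).roots + p.roots.toFinset.card := by
  have hp0 : p ≠ 0 := by rintro rfl; simp at hp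
  set g := shiftDeriv M p with hgdef
  set A := p.roots.toFinset
  set B := newShiftRoots M p with hB
  have hdisj : Disjoint A B := Finset.disjoint_sdiff
  have h1 : Multiset.card p.roots ≤ ∑ x ∈ A, g.rootMultiplicity x + A.card := by
    rw [← Multiset.toFinset_sum_count_eq, Finset.card_eq_sum_ones, ← Finset.sum_add_distrib]
    refine Finset.sum_le_sum fun x _ => ?_
    rw [count_roots, ← tsub_le_iff_right, le_rootMultiplicity_iff hg, hgdef, shiftDeriv]
    refine dvd_sub (pow_sub_one_dvd_derivative_of_pow_dvd (p.pow_rootMultiplicity_dvd x)) ?_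
    exact ((pow_dvd_pow _ (Nat.sub_le _ _)).trans (p.pow_rootMultiplicity_dvd x)).mul_left _
  have h2 : B.card + (B ∩ laguerreZeros p).card ≤ ∑ x ∈ B, g.rootMultiplicity x := by
    rw [← Finset.filter_mem_eq_inter, Finset.card_filter, Finset.card_eq_sum_ones,
      ← Finset.sum_add_distrib]
    refine Finset.sum_le_sum fun x hx => ?_
    have hx' := (mem_newShiftRoots hp0 hg).1 hx
    split_ifs with hz
    · refine Nat.succ_le_of_lt ((one_lt_rootMultiplicity_iff_isRoot hg).2 ⟨hx'.1, ?_⟩)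
      have h3 := ((mem_laguerreZeros hp).1 hz).1
      rw [eval_laguerre_eq_shiftDeriv p M x, hx'.1, mul_zero, sub_zero] at h3
      exact (mul_eq_zero.1 h3).resolve_left hx'.2
    · exact (rootMultiplicity_pos hg).2 hx'.1
  have h3 : ∑ x ∈ A, g.rootMultiplicity x + ∑ x ∈ B, g.rootMultiplicity x
      ≤ Multiset.card g.roots := by
    rw [← Finset.sum_union hdisj]
    simp only [← count_roots]
    rw [← Multiset.toFinset_sum_count_eq]
    refine (Finset.sum_le_sum_of_ne_zero fun x _ hx => ?_)
    rw [Multiset.mem_toFinset]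
    exact Multiset.count_ne_zero.1 hx
  omega

/-- The points β a are distinct because no zero of p lies in (a, β a]. -/
theorem card_roots_toFinset_le_card_newShiftRoots {M : ℝ} (hM : 0 < M) {p : ℝ[X]} (hp : p ≠ 0)
    {β : ℝ → ℝ} (hβ : ∀ a, p.eval a = 0 → IsNextShiftRoot M p a (β a)) :
    (p.roots.toFinset.image β ⊆ newShiftRoots M p) ∧
      (p.roots.toFinset.image β).card = p.roots.toFinset.card := by
  have hA : ∀ a, a ∈ p.roots.toFinset → p.eval a = 0 := fun a ha => by
    simpa [hp] using ha
  constructor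
  · intro b hb
    obtain ⟨a, ha, rfl⟩ := Finset.mem_image.1 hb
    have h := hβ a (hA a ha)
    exact (mem_newShiftRoots hp (shiftDeriv_ne_zero hM.ne' hp)).2 ⟨h.right, h.ne_zero _ ⟨h.lt, le_rfl⟩⟩
  · refine Finset.card_image_of_injOn ?_
    have key : ∀ a ∈ p.roots.toFinset, ∀ b ∈ p.roots.toFinset, β a = β b → ¬ a < b := by
      intro a ha b hb hab hlt
      refine (hβ a (hA a ha)).ne_zero b ⟨hlt, ?_⟩ (hA b hb)
      rw [hab]; exact (hβ b (hA b hb)).lt.le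
    intro a ha b hb hab
    exact le_antisymm (not_lt.1 (key b hb a ha hab.symm)) (not_lt.1 (key a ha b hb hab))

/-- `D - t` with `t > 0` does not increase the number of nonreal zeros. -/
theorem card_roots_le_card_roots_shiftDeriv {M : ℝ} (hM : 0 < M) (p : ℝ[X]) :
    Multiset.card p.roots ≤ Multiset.card (shiftDeriv M p).roots := by
  rcases Nat.eq_zero_or_pos p.natDegree with h | h
  · rw [eq_C_of_natDegree_eq_zero h]; simp
  have hp0 : p ≠ 0 := by rintro rfl; simp at h
  choose! β hβ using fun a (ha : p.eval a = 0) => exists_isNextShiftRoot hM hp0 ha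
  obtain ⟨h1, h2⟩ := card_roots_toFinset_le_card_newShiftRoots hM hp0 hβ
  have h3 := Finset.card_le_card h1
  have h4 := card_roots_add_card_newShiftRoots_le (M := M) h (shiftDeriv_ne_zero hM.ne' hp0)
  omega

theorem card_le_card_of_forall_exists_between {s t : Finset ℝ}
    (h : ∀ u ∈ s, ∃ w ∈ t, u < w ∧ ∀ v ∈ s, u < v → w < v) : s.card ≤ t.card := by
  choose! f hf1 hf2 hf3 using h
  refine Finset.card_le_card_of_injOn f hf1 ?_
  have key : ∀ u ∈ s, ∀ v ∈ s, f u = f v → ¬ u < v := fun u hu v hv huv hlt => by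
    have := hf3 u hu v hv hlt
    rw [huv] at this
    exact this.not_gt (hf2 v hv)
  intro u hu v hv huv
  exact le_antisymm (not_lt.1 (key v hv u hu huv.symm)) (not_lt.1 (key u hu v hv huv))

/-- Each zero u of (p'/p)' with g(u) ≠ 0 is matched, before the next such zero, with a zero of
(g'/g)' or with a new zero of g that is not of the form β a. -/
theorem card_laguerreZeros_sdiff_le {M : ℝ} (hM : 0 < M) {p : ℝ[X]} (hp : 1 ≤ p.natDegree)
    (hcrit : ∀ u ∈ laguerreZeros p, (derivative p).eval u / p.eval u ≤ M) :
    (laguerreZeros p \ newShiftRoots M p).card + p.roots.toFinset.card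
      ≤ (laguerreZeros (shiftDeriv M p)).card + (newShiftRoots M p).card := by
  have hp0 : p ≠ 0 := by rintro rfl; simp at hp
  have hg0 : shiftDeriv M p ≠ 0 := shiftDeriv_ne_zero hM.ne' hp0
  set g := shiftDeriv M p with hgdef
  have hgdeg : 1 ≤ g.natDegree := by rw [hgdef, natDegree_shiftDeriv hM.ne']; exact hp
  choose! β hβ using fun a (ha : p.eval a = 0) => exists_isNextShiftRoot hM hp0 ha
  obtain ⟨hsub, hcard⟩ := card_roots_toFinset_le_card_newShiftRoots hM hp0 hβ
  -- On (a, β a) one has p'/p > M, whereas `hcrit` bounds p'/p by M at the zeros of (p'/p)'.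
  have hfree : ∀ u ∈ laguerreZeros p, ∀ a, p.eval a = 0 → u ∉ Ioo a (β a) := by
    intro u hu a ha hmem
    have h1 := (hβ a ha).mul_pos hmem
    have h2 := hcrit u hu
    have h3 := ((mem_laguerreZeros hp).1 hu).2
    have h4 : 0 < p.eval u * p.eval u := mul_self_pos.2 h3
    have h5 : g.eval u = (derivative p).eval u - M * p.eval u := by simp [hgdef, shiftDeriv]
    rw [← hgdef, h5] at h1
    have h6 : (derivative p).eval u / p.eval u * (p.eval u * p.eval u)
        = (derivative p).eval u * p.eval u := by field_simp
    nlinarith [mul_le_mul_of_nonneg_right h2 h4.le]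
  set Z := laguerreZeros p \ newShiftRoots M p with hZ
  set B' := newShiftRoots M p \ p.roots.toFinset.image β with hB'
  have hZmem : ∀ u, u ∈ Z ↔ (p.laguerre.eval u = 0 ∧ p.eval u ≠ 0) ∧ g.eval u ≠ 0 := by
    intro u
    rw [hZ, Finset.mem_sdiff, mem_laguerreZeros hp, mem_newShiftRoots hp0 hg0, ← hgdef]
    tauto
  have hmain : Z.card ≤ (laguerreZeros g ∪ B').card := by
    refine card_le_card_of_forall_exists_between fun u hu => ?_
    obtain ⟨⟨hu1, hu2⟩, hu3⟩ := (hZmem u).1 hu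
    have huZ : u ∈ laguerreZeros p := (Finset.mem_sdiff.1 hu).1
    set F : ℝ → ℝ := fun x => Real.exp (-M * x) * p.laguerre.eval x / g.eval x with hF
    have hFd := fun x (hx : g.eval x ≠ 0) => hasDerivAt_exp_mul_laguerre_div p M hx
    have hFz : ∀ x, p.laguerre.eval x = 0 → F x = 0 := fun x hx => by simp [hF, hx]
    have hF' : ∀ c, p.eval c ≠ 0 → g.eval c ≠ 0 → Real.exp (-M * c) * p.eval c *
        g.laguerre.eval c / g.eval c ^ 2 = 0 → c ∈ laguerreZeros g := by
      intro c h1 h2 h3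
      refine (mem_laguerreZeros hgdeg).2 ⟨?_, h2⟩
      by_contra h4
      exact div_ne_zero (mul_ne_zero (mul_ne_zero (Real.exp_ne_zero _) h1) h4)
        (pow_ne_zero 2 h2) h3
    -- The match for u is governed by the first x in S. If x is a zero of p, the preceding key lemma
    -- applies; if x is a new zero of g, x itself serves; if x is in Z, Rolle applies to F on [u,
    -- x]. If S is empty, F tends to 0 at infinity and half-line Rolle applies.
    set S := (p.roots.toFinset ∪ newShiftRoots M p ∪ Z).filter (fun x => u < x) with hS
    have hSmem : ∀ x, x ∈ S ↔ (p.eval x = 0 ∨ x ∈ newShiftRoots M p ∨ x ∈ Z) ∧ u < x := by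
      intro x; simp [hS, hp0]
    have hSg : ∀ x, u < x → x ∉ S → p.eval x ≠ 0 ∧ g.eval x ≠ 0 := by
      intro x hux hx
      have h1 : p.eval x ≠ 0 := fun h => hx ((hSmem x).2 ⟨Or.inl h, hux⟩)
      exact ⟨h1, fun h => hx ((hSmem x).2
        ⟨Or.inr (Or.inl ((mem_newShiftRoots hp0 hg0).2 ⟨h, h1⟩)), hux⟩)⟩
    by_cases hSne : S.Nonempty
    · set x := S.min' hSne
      have hxS : x ∈ S := S.min'_mem hSne
      have hmin : ∀ y ∈ S, x ≤ y := fun y hy => S.min'_le y hy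
      obtain ⟨hx, hux⟩ := (hSmem x).1 hxS
      have hbetween : ∀ y ∈ Ioo u x, p.eval y ≠ 0 ∧ g.eval y ≠ 0 := fun y hy =>
        hSg y hy.1 fun h => (hmin y h).not_gt hy.2
      have hnext : ∀ v ∈ Z, u < v → x ≤ v := fun v hv huv =>
        hmin v ((hSmem v).2 ⟨Or.inr (Or.inr hv), huv⟩)
      have hIco : ∀ y ∈ Ico u x, p.eval y ≠ 0 ∧ g.eval y ≠ 0 := fun y hy => by
        rcases hy.1.eq_or_lt with h | h
        · rw [← h]; exact ⟨hu2, hu3⟩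
        · exact hbetween y ⟨h, hy.2⟩
      rcases hx with hx | hx | hx
      · obtain ⟨c, hc, hc1, hc2⟩ := exists_laguerre_shiftDeriv_eq_zero_of_isNextShiftRoot hp0 hu1 hux
          (fun y hy => (hIco y hy).1) (fun y hy => (hIco y hy).2) (hβ x hx)
        refine ⟨c, Finset.mem_union_left _ ((mem_laguerreZeros hgdeg).2 ⟨hc1, hc2⟩), hc.1, ?_⟩
        -- c may lie beyond x, but only within (u, β x), and (x, β x) contains no element of Z.
        intro v hv huv
        refine hc.2.trans_le (not_lt.1 fun hlt => ?_)
        refine hfree v (Finset.mem_sdiff.1 hv).1 x hx ⟨lt_of_le_of_ne (hnext v hv huv) ?_, hlt⟩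
        rintro h
        exact ((hZmem v).1 hv).1.2 (h ▸ hx)
      · refine ⟨x, Finset.mem_union_right _ (Finset.mem_sdiff.2 ⟨hx, fun hxi => ?_⟩), hux, ?_⟩
        · obtain ⟨a, ha, hax⟩ := Finset.mem_image.1 hxi
          have ha0 : p.eval a = 0 := by simpa [hp0] using ha
          -- If x = β a, then u would lie in (a, β a), contrary to `hfree`.
          have hau : a < u := by
            by_contra hcon
            rcases (not_lt.1 hcon).eq_or_lt with h | h
            · exact hu2 (h ▸ ha0)
            · have h1 := hmin a ((hSmem a).2 ⟨Or.inl ha0, h⟩)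
              have h2 := (hβ a ha0).lt
              rw [hax] at h2
              exact h1.not_gt h2
          exact hfree u huZ a ha0 ⟨hau, by rw [hax]; exact hux⟩
        · intro v hv huv
          refine lt_of_le_of_ne (hnext v hv huv) ?_
          rintro h
          exact (Finset.mem_sdiff.1 hv).2 (h ▸ hx)
      · obtain ⟨⟨hx1, hx2⟩, hx3⟩ := (hZmem x).1 hx
        have hIcc : ∀ y ∈ Icc u x, g.eval y ≠ 0 := fun y hy => by
          rcases hy.2.eq_or_lt with h | h
          · rw [h]; exact hx3
          · exact (hIco y ⟨hy.1, h⟩).2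
        obtain ⟨c, hc, hc0⟩ := exists_hasDerivAt_eq_zero hux (f := F)
          (fun y hy => (hFd y (hIcc y hy)).continuousAt.continuousWithinAt)
          ((hFz u hu1).trans (hFz x hx1).symm)
          (fun y hy => hFd y (hIcc y (Ioo_subset_Icc_self hy)))
        have h := hbetween c hc
        exact ⟨c, Finset.mem_union_left _ (hF' c h.1 h.2 hc0), hc.1,
          fun v hv huv => hc.2.trans_le (hnext v hv huv)⟩
    · have hfar : ∀ y ∈ Ioi u, p.eval y ≠ 0 ∧ g.eval y ≠ 0 := fun y hy =>
        hSg y hy fun h => hSne ⟨y, h⟩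
      have hIci : ∀ y ∈ Ici u, g.eval y ≠ 0 := fun y hy => by
        rcases (mem_Ici.1 hy).eq_or_lt with h | h
        · rw [← h]; exact hu3
        · exact (hfar y h).2
      obtain ⟨c, hc, hc0⟩ := exists_hasDerivAt_eq_zero_of_tendsto_atTop (F := F) (u := u)
        (fun y hy => (hFd y (hIci y hy)).continuousAt.continuousWithinAt) (hFz u hu1)
        (tendsto_exp_mul_eval_div hM _ hg0) (fun y hy => hFd y (hfar y hy).2)
      have h := hfar c hc
      exact ⟨c, Finset.mem_union_left _ (hF' c h.1 h.2 hc0), hc,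
        fun v hv huv => absurd ⟨v, (hSmem v).2 ⟨Or.inr (Or.inr hv), huv⟩⟩ hSne⟩
  have h1 := hmain.trans (Finset.card_union_le _ _)
  have h2 : B'.card = (newShiftRoots M p).card - p.roots.toFinset.card := by
    rw [hB', Finset.card_sdiff_of_subset hsub, hcard]
  have h3 := Finset.card_le_card hsub
  omega

theorem laguerre_comp_neg_X (p : ℝ[X]) : (p.comp (-X)).laguerre = p.laguerre.comp (-X) := by
  simp [laguerre, derivative_comp]

theorem laguerreZeros_comp_neg_X {p : ℝ[X]} (hp : 1 ≤ p.natDegree) :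
    laguerreZeros (p.comp (-X)) = (laguerreZeros p).image (fun x => -x) := by
  have hp' : 1 ≤ (p.comp (-X)).natDegree := by simpa [natDegree_comp] using hp
  ext x
  rw [mem_laguerreZeros hp', laguerre_comp_neg_X, Finset.mem_image]
  constructor
  · intro h
    exact ⟨-x, (mem_laguerreZeros hp).2 (by simpa using h), by simp⟩
  · rintro ⟨y, hy, rfl⟩
    simpa using (mem_laguerreZeros hp).1 hy

/-- If all real critical values of `p' / p` vanish, its critical points are multiple zeros of
`p'`. -/
theorem card_laguerreZeros_add_card_roots_le_of_eq_zero {p : ℝ[X]} (hp : 1 ≤ p.natDegree)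
    (h : ∀ u ∈ laguerreZeros p, (derivative p).eval u = 0) :
    (laguerreZeros p).card + Multiset.card p.roots ≤ p.natDegree := by
  have hp0 : p ≠ 0 := by rintro rfl; simp at hp
  have hs : shiftDeriv 0 p = derivative p := by simp [shiftDeriv]
  have hg0 : shiftDeriv 0 p ≠ 0 := by
    rw [hs]; intro h0
    rw [eq_C_of_derivative_eq_zero h0] at hp; simp at hp
  have h1 := card_roots_add_card_newShiftRoots_le hp hg0
  have h2 : laguerreZeros p ⊆ newShiftRoots 0 p := fun u hu =>
    (mem_newShiftRoots hp0 hg0).2 ⟨by rw [hs]; exact h u hu, ((mem_laguerreZeros hp).1 hu).2⟩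
  -- Rolle gives at least one fewer new zero of p' than p has distinct zeros; this loss of one is
  -- offset by deg p' < deg p.
  rw [Finset.inter_eq_right.2 h2] at h1
  have h3 := card_roots_toFinset_le_card_roots_derivative_sdiff_roots_succ p
  have h4 : (newShiftRoots 0 p).card
      = ((derivative p).roots.toFinset \ p.roots.toFinset).card := by
    rw [newShiftRoots, hs]
  have h5 := card_roots' (derivative p)
  have h6 := natDegree_derivative_lt (p := p) (by omega)
  rw [hs] at h1
  omega

/-- A real polynomial `p` has at least as many nonreal zeros as `(p' / p)'` has distinct real
zeros. -/
theorem card_laguerreZeros_add_card_roots_le {p : ℝ[X]} (hp : 1 ≤ p.natDegree) :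
    (laguerreZeros p).card + Multiset.card p.roots ≤ p.natDegree := by
  -- The induction is on the number of nonreal zeros.
  induction hn : p.natDegree - Multiset.card p.roots using Nat.strong_induction_on
    generalizing p with
  | _ n ih =>
  have hpos : ∀ q : ℝ[X], 1 ≤ q.natDegree → q.natDegree - Multiset.card q.roots = n →
      (∃ u ∈ laguerreZeros q, 0 < (derivative q).eval u / q.eval u) →
      (laguerreZeros q).card + Multiset.card q.roots ≤ q.natDegree := by
    rintro q hq hqn ⟨u₀, hu₀, hu₀pos⟩
    have hq0 : q ≠ 0 := by rintro rfl; simp at hq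
    -- Maximality of M gives the bound on critical values needed for the count; attainment at u
    -- gives a multiple new zero of q' - Mq.
    obtain ⟨u, hu, hmax⟩ := (laguerreZeros q).exists_max_image
      (fun u => (derivative q).eval u / q.eval u) ⟨u₀, hu₀⟩
    set M := (derivative q).eval u / q.eval u with hMdef
    have hM : 0 < M := hu₀pos.trans_le (hmax u₀ hu₀)
    have hg0 := shiftDeriv_ne_zero (p := q) hM.ne' hq0
    -- Added up, `h1`, `h2`, `h3` say that distinct zeros of (q'/q)' plus real zeros of q do not
    -- exceed the same sum for q' - Mq, of equal degree. Nonemptiness in `h4` makes the number of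
    -- nonreal zeros drop.
    have h1 := card_laguerreZeros_sdiff_le hM hq hmax
    have h2 := card_roots_add_card_newShiftRoots_le hq hg0
    have h3 := Finset.card_sdiff_add_card_inter (laguerreZeros q) (newShiftRoots M q)
    have h4 : 0 < (newShiftRoots M q ∩ laguerreZeros q).card := by
      refine Finset.card_pos.2 ⟨u, Finset.mem_inter.2 ⟨(mem_newShiftRoots hq0 hg0).2 ?_, hu⟩⟩
      have h5 := ((mem_laguerreZeros hq).1 hu).2
      refine ⟨?_, h5⟩
      simp [shiftDeriv, hMdef, div_mul_cancel₀ _ h5]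
    choose! β hβ using fun a (ha : q.eval a = 0) => exists_isNextShiftRoot hM hq0 ha
    obtain ⟨h6, h7⟩ := card_roots_toFinset_le_card_newShiftRoots hM hq0 hβ
    have h8 := Finset.card_le_card h6
    have h9 := natDegree_shiftDeriv (p := q) hM.ne'
    have h10 := card_roots' (shiftDeriv M q)
    have h11 := ih ((shiftDeriv M q).natDegree - Multiset.card (shiftDeriv M q).roots)
      (by omega) (by omega) rfl
    rw [Finset.inter_comm] at h3
    omega
  by_cases h1 : ∃ u ∈ laguerreZeros p, 0 < (derivative p).eval u / p.eval u
  · exact hpos p hp hn h1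
  by_cases h2 : ∃ u ∈ laguerreZeros p, (derivative p).eval u / p.eval u < 0
  · obtain ⟨u, hu, hneg⟩ := h2
    have hd : (p.comp (-X)).natDegree = p.natDegree := by simp [natDegree_comp]
    have hr : Multiset.card (p.comp (-X)).roots = Multiset.card p.roots := by
      simp [roots_comp_neg_X]
    have hz := laguerreZeros_comp_neg_X hp
    have := hpos (p.comp (-X)) (by omega) (by omega) ⟨-u, ?_, ?_⟩
    · rw [hz, Finset.card_image_of_injective _ neg_injective] at this
      omega
    · rw [hz]; exact Finset.mem_image_of_mem _ hu
    · simp only [derivative_comp, derivative_neg, derivative_X, eval_mul, eval_neg, eval_one,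
        eval_comp, eval_X, neg_neg]
      rw [mul_comm, mul_neg_one, neg_div]
      exact neg_pos.2 hneg
  · refine card_laguerreZeros_add_card_roots_le_of_eq_zero hp fun u hu => ?_
    push Not at h1 h2
    have := le_antisymm (h1 u hu) (h2 u hu)
    exact (div_eq_zero_iff.1 this).resolve_right ((mem_laguerreZeros hp).1 hu).2
end Polynomial

/-! ### Real analytic functions: from multiplicities to sign changes -/

/-- The operator `D - t`. -/
noncomputable def derivSub (t : ℝ) (r : ℝ → ℝ) : ℝ → ℝ := fun x => deriv r x - t * r x

/-- The Laguerre expression `r r'' - r' ^ 2`. -/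
noncomputable def laguerreExpr (r : ℝ → ℝ) : ℝ → ℝ :=
  fun x => r x * deriv (deriv r) x - deriv r x ^ 2

theorem AnalyticOnNhd.derivSub {r : ℝ → ℝ} (hr : AnalyticOnNhd ℝ r univ) (t : ℝ) :
    AnalyticOnNhd ℝ (derivSub t r) univ :=
  hr.deriv.sub (analyticOnNhd_const.mul hr)

theorem AnalyticOnNhd.laguerreExpr {r : ℝ → ℝ} (hr : AnalyticOnNhd ℝ r univ) :
    AnalyticOnNhd ℝ (laguerreExpr r) univ :=
  (hr.mul hr.deriv.deriv).sub (hr.deriv.pow 2)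

theorem AnalyticOnNhd.hasDerivAt_of_univ {r : ℝ → ℝ} (hr : AnalyticOnNhd ℝ r univ) (x : ℝ) :
    HasDerivAt r (deriv r x) x :=
  (hr x (mem_univ x)).differentiableAt.hasDerivAt

theorem deriv_derivSub {r : ℝ → ℝ} (hr : AnalyticOnNhd ℝ r univ) (t : ℝ) :
    deriv (derivSub t r) = derivSub t (deriv r) := by
  ext x
  exact ((hr.deriv.hasDerivAt_of_univ x).sub ((hr.hasDerivAt_of_univ x).const_mul t)).deriv

theorem mul_laguerreExpr_derivSub {r : ℝ → ℝ} (hr : AnalyticOnNhd ℝ r univ) (t x : ℝ) :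
    r x * laguerreExpr (derivSub t r) x =
      (deriv (laguerreExpr r) x - t * laguerreExpr r x) * derivSub t r x
        - laguerreExpr r x * deriv (derivSub t r) x := by
  have h1 : deriv (laguerreExpr r) x = deriv r x * deriv (deriv r) x
      + r x * deriv (deriv (deriv r)) x - 2 * deriv r x * deriv (deriv r) x := by
    have := (((hr.hasDerivAt_of_univ x).mul (hr.deriv.deriv.hasDerivAt_of_univ x)).sub
      ((hr.deriv.hasDerivAt_of_univ x).pow 2)).deriv
    refine Eq.trans this ?_
    simp
  simp only [h1, deriv_derivSub hr, deriv_derivSub hr.deriv, laguerreExpr, derivSub]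
  ring

theorem eventually_quadratic_pos {α : ℝ} (hα : 0 < α) (β γ : ℝ) :
    ∀ᶠ t : ℝ in atTop, 0 < α * t ^ 2 + β * t + γ := by
  filter_upwards [eventually_ge_atTop ((|β| + |γ| + 1) / α), eventually_ge_atTop 1] with t h1 h2
  rw [div_le_iff₀ hα] at h1
  have h3 := neg_abs_le β
  have h4 := neg_abs_le γ
  have h5 := abs_nonneg γ
  have h6 : (|β| + |γ| + 1) * t ≤ t * α * t := mul_le_mul_of_nonneg_right h1 (by linarith)
  nlinarith

theorem eventually_linear_pos {α : ℝ} (hα : 0 < α) (β : ℝ) :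
    ∀ᶠ t : ℝ in atTop, 0 < α * t + β := by
  filter_upwards [eventually_gt_atTop (-β / α)] with t ht
  rw [div_lt_iff₀ hα] at ht
  linarith

/-- Near a zero of order `j + 1` of its Laguerre expression, an analytic function `r` can be replaced by
`r' - t r` with `t` large: the order drops by one, and a sign change appears to the right. -/
theorem eventually_exists_sign_change_derivSub {r : ℝ → ℝ} (hr : AnalyticOnNhd ℝ r univ)
    {x : ℝ} (hrx : r x ≠ 0) {j : ℕ} (hord : analyticOrderAt (laguerreExpr r) x = (j + 1 : ℕ)) :
    ∀ᶠ η : ℝ in 𝓝[>] 0, ∀ᶠ t : ℝ in atTop,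
      (∀ y ∈ Icc x (x + η), derivSub t r y ≠ 0) ∧
      (∃ a ∈ Ioo x (x + η), ∃ b ∈ Ioo x (x + η),
        laguerreExpr (derivSub t r) a * laguerreExpr (derivSub t r) b < 0) ∧
      analyticOrderAt (laguerreExpr (derivSub t r)) x = j := by
  obtain ⟨u, hu, hux, hW⟩ :=
    ((hr.laguerreExpr x (mem_univ x)).analyticOrderAt_eq_natCast).1 hord
  -- With L[r] = (y - x)^(j+1) u, the identity `mul_laguerreExpr_derivSub` becomes r L[r' - tr] = (y
  -- - x)^j · bracket.
  set bracket : ℝ → ℝ → ℝ := fun t y =>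
    (((j : ℝ) + 1) * u y + (y - x) * deriv u y - t * ((y - x) * u y)) * derivSub t r y
      - (y - x) * u y * deriv (derivSub t r) y with hbr
  have hid : ∀ᶠ y in 𝓝 x, AnalyticAt ℝ u y ∧ 0 < u x * u y ∧ 0 < r x * r y ∧
      ∀ t, r y * laguerreExpr (derivSub t r) y = (y - x) ^ j * bracket t y := by
    have hpos : ∀ {f : ℝ → ℝ}, AnalyticAt ℝ f x → f x ≠ 0 → ∀ᶠ y in 𝓝 x, 0 < f x * f y := by
      intro f hf hfx
      exact (continuousAt_const.mul hf.continuousAt).eventually_const_lt (mul_self_pos.2 hfx)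
    filter_upwards [hu.eventually_analyticAt, hpos hu hux, hpos (hr x (mem_univ x)) hrx,
      hW.eventually_nhds] with y h1 h2 h3 h4
    refine ⟨h1, h2, h3, fun t => ?_⟩
    have h5 : deriv (laguerreExpr r) y =
        (y - x) ^ j * (((j : ℝ) + 1) * u y + (y - x) * deriv u y) := by
      have h6 : HasDerivAt (fun z => (z - x) ^ (j + 1) • u z)
          (((j + 1 : ℕ) * (y - x) ^ j * 1) * u y + (y - x) ^ (j + 1) * deriv u y) y :=
        (((hasDerivAt_id y).sub_const x).pow (j + 1)).mul h1.differentiableAt.hasDerivAt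
      rw [Filter.EventuallyEq.deriv_eq h4, h6.deriv]
      push_cast; ring
    rw [mul_laguerreExpr_derivSub hr, h5, h4.self_of_nhds, hbr]
    simp only [smul_eq_mul]; ring
  obtain ⟨ε, hε, hball⟩ := Metric.eventually_nhds_iff_ball.1 hid
  have hmem : ∀ η : ℝ, η < ε → ∀ y ∈ Icc x (x + η), y ∈ Metric.ball x ε := by
    intro η hη y hy
    rw [Metric.mem_ball, Real.dist_eq, abs_of_nonneg (by linarith [hy.1])]
    linarith [hy.2]
  filter_upwards [Ioo_mem_nhdsGT hε] with η hη
  have hr0 : ∀ y ∈ Icc x (x + η), r y ≠ 0 := fun y hy h0 => by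
    have := (hball y (hmem η hη.2 y hy)).2.2.1
    rw [h0, mul_zero] at this
    exact lt_irrefl _ this
  obtain ⟨C, hC⟩ := (isCompact_Icc (a := x) (b := x + η)).bddAbove_image
    (f := fun y => deriv r y / r y)
    ((hr.deriv.continuousOn.mono (subset_univ _)).div (hr.continuousOn.mono (subset_univ _)) hr0)
  set y₁ := x + η / 2 with hy₁
  have hy₁m : y₁ ∈ Icc x (x + η) := ⟨by linarith [hη.1], by linarith [hη.1]⟩
  obtain ⟨-, hu1, hr1, -⟩ := hball y₁ (hmem η hη.2 y₁ hy₁m)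
  have hη2 : 0 < y₁ - x := by linarith [hη.1]
  have hs : 0 < (u x * u y₁) * (r x * r y₁) := mul_pos hu1 hr1
  -- At y₁ > x the dominant term of the bracket is t²(y₁ - x)ur; at x itself it is -t(j + 1)ur. The
  -- signs are opposite for large t.
  have e1 : ∀ᶠ t in atTop, 0 < (u x * r x) * bracket t y₁ := by
    filter_upwards [eventually_quadratic_pos (mul_pos hη2 hs)
      ((u x * r x) * (-(((j : ℝ) + 1) * u y₁ + (y₁ - x) * deriv u y₁) * r y₁
        - (y₁ - x) * u y₁ * deriv r y₁ + (y₁ - x) * u y₁ * deriv r y₁))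
      ((u x * r x) * ((((j : ℝ) + 1) * u y₁ + (y₁ - x) * deriv u y₁) * deriv r y₁
        - (y₁ - x) * u y₁ * deriv (deriv r) y₁))] with t ht
    refine ht.trans_eq ?_
    simp only [hbr, deriv_derivSub hr, derivSub]; ring
  have e2 : ∀ᶠ t in atTop, 0 < -((u x * r x) * bracket t x) := by
    filter_upwards [eventually_linear_pos
      (mul_pos (mul_pos (Nat.cast_add_one_pos j) (mul_self_pos.2 hux)) (mul_self_pos.2 hrx))
      (-((j : ℝ) + 1) * (u x * u x) * r x * deriv r x)] with t ht
    refine ht.trans_eq ?_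
    simp only [hbr, derivSub]; ring
  filter_upwards [e1, e2, eventually_gt_atTop C] with t h1 h2 h3
  have hbc : ∀ y ∈ Metric.ball x ε, AnalyticAt ℝ (bracket t) y := by
    intro y hy
    have hua := (hball y hy).1
    have hg := hr.derivSub t y (mem_univ y)
    have hg' := (hr.derivSub t).deriv y (mem_univ y)
    have hid : AnalyticAt ℝ (fun y => y - x) y := by fun_prop
    exact ((((analyticAt_const.mul hua).add (hid.mul hua.deriv)).sub
      (analyticAt_const.mul (hid.mul hua))).mul hg).sub ((hid.mul hua).mul hg')
  have hbx : bracket t x ≠ 0 := by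
    intro h0; rw [h0] at h2; simp at h2
  refine ⟨fun y hy h0 => ?_, ?_, ?_⟩
  · have h4 : deriv r y / r y ≤ C := hC (mem_image_of_mem _ hy)
    have h5 : deriv r y = t * r y := sub_eq_zero.1 h0
    rw [h5, mul_div_cancel_right₀ _ (hr0 y hy)] at h4
    exact h4.not_gt h3
  · have hxb : x ∈ Metric.ball x ε := Metric.mem_ball_self hε
    -- The factor (y - x)^j may vanish at x, so the sign at x is carried to a nearby point a > x.
    have hcont : ∀ᶠ a in 𝓝 x, 0 < -((u x * r x) * bracket t a) :=
      ((continuousAt_const.mul (hbc x hxb).continuousAt).neg).eventually_const_lt h2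
    obtain ⟨a, ha1, ha2⟩ := ((hcont.filter_mono nhdsWithin_le_nhds).and
      (Ioo_mem_nhdsGT (show x < x + η by linarith [hη.1]))).exists
    refine ⟨a, ha2, y₁, ⟨by linarith, by linarith [hη.1]⟩, ?_⟩
    obtain ⟨-, -, hra, hia⟩ := hball a (hmem η hη.2 a (Ioo_subset_Icc_self ha2))
    obtain ⟨-, -, -, hib⟩ := hball y₁ (hmem η hη.2 y₁ hy₁m)
    have h4 : 0 < a - x := sub_pos.2 ha2.1
    have h5 : 0 < (a - x) ^ j * (y₁ - x) ^ j *
        (-((u x * r x) * bracket t a) * ((u x * r x) * bracket t y₁)) := by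
      have := mul_pos ha1 h1
      positivity
    have h6 : (a - x) ^ j * (y₁ - x) ^ j *
        (-((u x * r x) * bracket t a) * ((u x * r x) * bracket t y₁)) =
        -(u x ^ 2) * ((r x * r a) * (r x * r y₁)) * (laguerreExpr (derivSub t r) a
          * laguerreExpr (derivSub t r) y₁) := by
      linear_combination (u x ^ 2 * r x ^ 2) * (r y₁ * laguerreExpr (derivSub t r) y₁ * hia t
        + (a - x) ^ j * bracket t a * hib t)
    rw [h6] at h5
    by_contra hcon
    have h7 := mul_pos hra hr1
    have h8 : 0 ≤ u x ^ 2 * ((r x * r a) * (r x * r y₁)) * (laguerreExpr (derivSub t r) a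
        * laguerreExpr (derivSub t r) y₁) := by
      have := not_lt.1 hcon
      positivity
    linarith
  · rw [((hr.derivSub t).laguerreExpr x (mem_univ x)).analyticOrderAt_eq_natCast]
    refine ⟨fun y => bracket t y / r y, (hbc x (Metric.mem_ball_self hε)).div (hr x (mem_univ x)) hrx,
      div_ne_zero hbx hrx, ?_⟩
    filter_upwards [hid] with y hy
    have : r y ≠ 0 := fun h0 => by
      have := hy.2.2.1
      rw [h0, mul_zero] at this
      exact lt_irrefl _ this
    rw [smul_eq_mul, mul_div_assoc', ← hy.2.2.2 t, mul_div_cancel_left₀ _ this]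

/-- `r` has no zero on `N` disjoint compact intervals on each of which its Laguerre expression
changes sign. -/
def HasSignChanges (r : ℝ → ℝ) (N : ℕ) : Prop :=
  ∃ (X : Finset ℝ) (η : ℝ), N ≤ X.card ∧ (∀ x ∈ X, ∀ y ∈ X, x < y → x + η < y) ∧
    ∀ x ∈ X, (∀ y ∈ Icc x (x + η), r y ≠ 0) ∧
      ∃ a ∈ Icc x (x + η), ∃ b ∈ Icc x (x + η), laguerreExpr r a * laguerreExpr r b < 0

/-- The product of the operators `D - t`, for `t` in a list. -/
noncomputable def iterDerivSub (ts : List ℝ) (r : ℝ → ℝ) : ℝ → ℝ :=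
  ts.foldl (fun r t => derivSub t r) r

theorem exists_lt_forall_add_lt (X : Finset ℝ) :
    ∀ᶠ η : ℝ in 𝓝[>] 0, ∀ x ∈ X, ∀ y ∈ X, x < y → x + η < y := by
  refine (Filter.eventually_all_finset X).2 fun x _ => (Filter.eventually_all_finset X).2 fun y _ => ?_
  by_cases h : x < y
  · filter_upwards [Ioo_mem_nhdsGT (sub_pos.2 h)] with η hη _
    linarith [hη.2]
  · exact Eventually.of_forall fun η h' => absurd h' h

/-- One η and then one t serve all of the finite set X. -/
theorem exists_derivSub_sign_changes {r : ℝ → ℝ} (hr : AnalyticOnNhd ℝ r univ)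
    (hfin : ∀ x, analyticOrderAt (laguerreExpr r) x ≠ ⊤) {X : Finset ℝ}
    (hX : ∀ x ∈ X, r x ≠ 0 ∧ laguerreExpr r x = 0) :
    ∃ t > 0, ∃ η > 0, (∀ x ∈ X, ∀ y ∈ X, x < y → x + η < y) ∧
      ∀ x ∈ X, (∀ y ∈ Icc x (x + η), derivSub t r y ≠ 0) ∧
      (∃ a ∈ Ioo x (x + η), ∃ b ∈ Ioo x (x + η),
        laguerreExpr (derivSub t r) a * laguerreExpr (derivSub t r) b < 0) ∧
      analyticOrderAt (laguerreExpr (derivSub t r)) x =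
        (analyticOrderNatAt (laguerreExpr r) x - 1 : ℕ) := by
  have hloc : ∀ x ∈ X, ∀ᶠ η : ℝ in 𝓝[>] 0, ∀ᶠ t : ℝ in atTop,
      (∀ y ∈ Icc x (x + η), derivSub t r y ≠ 0) ∧
      (∃ a ∈ Ioo x (x + η), ∃ b ∈ Ioo x (x + η),
        laguerreExpr (derivSub t r) a * laguerreExpr (derivSub t r) b < 0) ∧
      analyticOrderAt (laguerreExpr (derivSub t r)) x =
        (analyticOrderNatAt (laguerreExpr r) x - 1 : ℕ) := by
    intro x hx
    have h0 : analyticOrderNatAt (laguerreExpr r) x ≠ 0 := by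
      intro h
      have h1 := Nat.cast_analyticOrderNatAt (hfin x)
      rw [h, Nat.cast_zero] at h1
      exact (hr.laguerreExpr x (mem_univ x)).analyticOrderAt_eq_zero.1 h1.symm (hX x hx).2
    refine eventually_exists_sign_change_derivSub hr (hX x hx).1 ?_
    rw [Nat.sub_add_cancel (Nat.one_le_iff_ne_zero.2 h0), Nat.cast_analyticOrderNatAt (hfin x)]
  obtain ⟨η, ⟨h1, h2⟩, h3⟩ := (((exists_lt_forall_add_lt X).and
    ((Filter.eventually_all_finset X).2 hloc)).and (self_mem_nhdsWithin)).exists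
  obtain ⟨t, h4, h5⟩ := (((Filter.eventually_all_finset X).2 h2).and (eventually_gt_atTop 0)).exists
  exact ⟨t, h5, η, h3, h1, h4⟩

/-- Zeros of the Laguerre expression, with multiplicities, become sign changes under suitable
operators `D - t`. -/
theorem exists_hasSignChanges_iterDerivSub {r : ℝ → ℝ} (hr : AnalyticOnNhd ℝ r univ)
    (hfin : ∀ x, analyticOrderAt (laguerreExpr r) x ≠ ⊤) {X : Finset ℝ}
    (hX : ∀ x ∈ X, r x ≠ 0 ∧ laguerreExpr r x = 0) {N : ℕ}
    (hN : N ≤ ∑ x ∈ X, analyticOrderNatAt (laguerreExpr r) x) :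
    ∃ ts : List ℝ, (∀ t ∈ ts, 0 < t) ∧ HasSignChanges (iterDerivSub ts r) N := by
  induction hn : N - X.card using Nat.strong_induction_on generalizing r X with
  | _ n ih =>
  obtain ⟨t, ht, η, hη, hsep, hstep⟩ := exists_derivSub_sign_changes hr hfin hX
  by_cases hcard : N ≤ X.card
  · refine ⟨[t], by simpa using ht, X, η, hcard, hsep, fun x hx => ?_⟩
    obtain ⟨h1, ⟨a, ha, b, hb, hab⟩, -⟩ := hstep x hx
    exact ⟨h1, a, Ioo_subset_Icc_self ha, b, Ioo_subset_Icc_self hb, hab⟩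
  have hr' := hr.derivSub t
  have hk : ∀ x ∈ X, 1 ≤ analyticOrderNatAt (laguerreExpr r) x := by
    intro x hx
    refine Nat.one_le_iff_ne_zero.2 fun h => ?_
    have h1 := Nat.cast_analyticOrderNatAt (hfin x)
    rw [h, Nat.cast_zero] at h1
    exact (hr.laguerreExpr x (mem_univ x)).analyticOrderAt_eq_zero.1 h1.symm (hX x hx).2
  have hXne : X.Nonempty := by
    rw [Finset.nonempty_iff_ne_empty]; rintro rfl
    simp at hN; omega
  obtain ⟨x₀, hx₀⟩ := hXne
  have hfin' : ∀ x, analyticOrderAt (laguerreExpr (derivSub t r)) x ≠ ⊤ := fun x =>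
    hr'.laguerreExpr.analyticOrderAt_ne_top_of_isPreconnected isPreconnected_univ
      (mem_univ x₀) (mem_univ x) (by rw [(hstep x₀ hx₀).2.2]; exact ENat.natCast_ne_top _)
  have hzero : ∀ x ∈ X, ∃ y ∈ Ioo x (x + η), laguerreExpr (derivSub t r) y = 0 := by
    intro x hx
    obtain ⟨-, ⟨a, ha, b, hb, hab⟩, -⟩ := hstep x hx
    by_contra hcon
    push Not at hcon
    exact (mul_pos_of_ne_zero_of_ordConnected ordConnected_Ioo
      (hr'.laguerreExpr.continuousOn.mono (subset_univ _)) hcon ha hb).not_gt hab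
  choose! y hy hy0 using hzero
  have hyinj : Set.InjOn y X := by
    have key : ∀ a ∈ X, ∀ b ∈ X, y a = y b → ¬ a < b := fun a ha b hb hab hlt => by
      have h1 := (hy a ha).2
      have h2 := (hy b hb).1
      have h3 := hsep a ha b hb hlt
      linarith
    intro a ha b hb hab
    exact le_antisymm (not_lt.1 (key b hb a ha hab.symm)) (not_lt.1 (key a ha b hb hab))
  have hyX : ∀ x ∈ X, y x ∉ X := fun x hx hmem => by
    have h1 := hsep x hx _ hmem (hy x hx).1
    exact h1.not_gt (hy x hx).2
  -- A zero of order k leaves order k - 1 at x and gains a zero at y x. The total order does not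
  -- fall, while the number of distinct points grows by |X₂|, which is positive as long as N > |X|.
  set X₂ := X.filter (fun x => 2 ≤ analyticOrderNatAt (laguerreExpr r) x) with hX₂
  have hdisj : Disjoint X₂ (X.image y) := by
    rw [Finset.disjoint_left]
    intro z hz hz'
    obtain ⟨x, hx, rfl⟩ := Finset.mem_image.1 hz'
    exact hyX x hx (Finset.mem_filter.1 hz).1
  have hordX : ∀ x ∈ X, analyticOrderNatAt (laguerreExpr (derivSub t r)) x =
      analyticOrderNatAt (laguerreExpr r) x - 1 := fun x hx => by
    rw [analyticOrderNatAt, (hstep x hx).2.2]; rfl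
  have hzeroord : ∀ z, laguerreExpr (derivSub t r) z = 0 ↔
      1 ≤ analyticOrderNatAt (laguerreExpr (derivSub t r)) z := by
    intro z
    rw [← not_iff_not, ← ne_eq, ← (hr'.laguerreExpr z (mem_univ z)).analyticOrderAt_eq_zero,
      ← Nat.cast_analyticOrderNatAt (hfin' z)]
    simp
  have hX₂ne : X₂.Nonempty := by
    by_contra hcon
    rw [Finset.not_nonempty_iff_eq_empty, hX₂, Finset.filter_eq_empty_iff] at hcon
    have : ∑ x ∈ X, analyticOrderNatAt (laguerreExpr r) x ≤ ∑ x ∈ X, 1 :=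
      Finset.sum_le_sum fun x hx => by have := hcon hx; omega
    simp at this; omega
  have hcard' : (X₂ ∪ X.image y).card = X₂.card + X.card := by
    rw [Finset.card_union_of_disjoint hdisj, Finset.card_image_of_injOn hyinj]
  have hpos := hX₂ne.card_pos
  have hzero' : ∀ z ∈ X₂ ∪ X.image y, derivSub t r z ≠ 0 ∧ laguerreExpr (derivSub t r) z = 0 := by
    intro z hz
    rcases Finset.mem_union.1 hz with hz | hz
    · obtain ⟨hz1, hz2⟩ := Finset.mem_filter.1 hz
      refine ⟨(hstep z hz1).1 z ⟨le_rfl, by linarith⟩, (hzeroord z).2 ?_⟩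
      rw [hordX z hz1]; omega
    · obtain ⟨x, hx, rfl⟩ := Finset.mem_image.1 hz
      exact ⟨(hstep x hx).1 _ (Ioo_subset_Icc_self (hy x hx)), hy0 x hx⟩
  have hsum : N ≤ ∑ z ∈ X₂ ∪ X.image y, analyticOrderNatAt (laguerreExpr (derivSub t r)) z := by
    rw [Finset.sum_union hdisj, Finset.sum_image hyinj, hX₂, Finset.sum_filter,
      ← Finset.sum_add_distrib]
    refine hN.trans (Finset.sum_le_sum fun x hx => ?_)
    have h1 := (hzeroord _).1 (hy0 x hx)
    have h2 := hk x hx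
    have h3 := hordX x hx
    split_ifs with h <;> omega
  obtain ⟨ts, hts, hres⟩ := ih (N - (X₂ ∪ X.image y).card) (by omega) hr' hfin' hzero' hsum rfl
  exact ⟨t :: ts, by simpa using ⟨ht, hts⟩, hres⟩

/-! ### The bound on sign changes for polynomials -/

theorem laguerreExpr_eval (p : ℝ[X]) :
    laguerreExpr (fun x => p.eval x) = fun x => p.laguerre.eval x := by
  ext x
  have h1 : ∀ q : ℝ[X], deriv (fun x => q.eval x) = fun x => (derivative q).eval x :=
    fun q => funext fun x => q.deriv
  simp only [laguerreExpr, h1, Polynomial.laguerre, eval_sub, eval_mul, eval_pow]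

theorem derivSub_eval (t : ℝ) (p : ℝ[X]) :
    derivSub t (fun x => p.eval x) = fun x => (p.shiftDeriv t).eval x := by
  ext x
  simp [derivSub, Polynomial.shiftDeriv]

/-- Each interval carries a zero of L[p] where p ≠ 0, and disjoint intervals give distinct ones. -/
theorem le_of_hasSignChanges_eval {p : ℝ[X]} {N m : ℕ}
    (hp : p.natDegree ≤ m + Multiset.card p.roots)
    (h : HasSignChanges (fun x => p.eval x) N) : N ≤ m := by
  obtain ⟨X, η, hN, hsep, hX⟩ := h
  rw [laguerreExpr_eval] at hX
  rcases Nat.eq_zero_or_pos p.natDegree with hd | hd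
  · rw [eq_C_of_natDegree_eq_zero hd] at hX
    have : X = ∅ := by
      rw [Finset.eq_empty_iff_forall_notMem]
      intro x hx
      obtain ⟨-, a, -, b, -, hab⟩ := hX x hx
      simp [Polynomial.laguerre] at hab
    simp [this] at hN; omega
  have hzero : ∀ x ∈ X, ∃ y ∈ Icc x (x + η), p.laguerre.eval y = 0 := by
    intro x hx
    obtain ⟨-, a, ha, b, hb, hab⟩ := hX x hx
    by_contra hcon
    push Not at hcon
    exact (mul_pos_of_ne_zero_of_ordConnected ordConnected_Icc p.laguerre.continuousOn hcon
      ha hb).not_gt hab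
  choose! y hy hy0 using hzero
  have hyinj : Set.InjOn y X := by
    have key : ∀ a ∈ X, ∀ b ∈ X, y a = y b → ¬ a < b := fun a ha b hb hab hlt => by
      have h1 := (hy a ha).2
      have h2 := (hy b hb).1
      have h3 := hsep a ha b hb hlt
      linarith
    intro a ha b hb hab
    exact le_antisymm (not_lt.1 (key b hb a ha hab.symm)) (not_lt.1 (key a ha b hb hab))
  have h1 : X.card ≤ (laguerreZeros p).card := Finset.card_le_card_of_injOn y
    (fun x hx => (mem_laguerreZeros hd).2 ⟨hy0 x hx, (hX x hx).1 _ (hy x hx)⟩) hyinj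
  have h2 := card_laguerreZeros_add_card_roots_le hd
  omega

theorem le_of_hasSignChanges_iterDerivSub_eval {p : ℝ[X]} {N m : ℕ}
    (hp : p.natDegree ≤ m + Multiset.card p.roots) {ts : List ℝ} (hts : ∀ t ∈ ts, 0 < t)
    (h : HasSignChanges (iterDerivSub ts (fun x => p.eval x)) N) : N ≤ m := by
  induction ts generalizing p with
  | nil => exact le_of_hasSignChanges_eval hp h
  | cons t ts ih =>
    have ht : 0 < t := hts t (by simp)
    refine ih (p := p.shiftDeriv t) ?_ (fun s hs => hts s (by simp [hs])) ?_
    · rw [natDegree_shiftDeriv ht.ne']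
      have := card_roots_le_card_roots_shiftDeriv ht p
      omega
    · rw [← derivSub_eval]; exact h

/-! ### Entire functions and locally uniform limits -/

/-- The operator `D - t` on functions of a complex variable. -/
noncomputable def cderivSub (t : ℝ) (f : ℂ → ℂ) : ℂ → ℂ := fun z => deriv f z - (t : ℂ) * f z

/-- The product of the operators `D - t`, for `t` in a list. -/
noncomputable def iterCderivSub (ts : List ℝ) (f : ℂ → ℂ) : ℂ → ℂ :=
  ts.foldl (fun f t => cderivSub t f) f

/-- The real part of the restriction to the real axis. -/
def realRestrict (f : ℂ → ℂ) : ℝ → ℝ := fun x => (f x).re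

theorem Differentiable.deriv_complex {f : ℂ → ℂ} (hf : Differentiable ℂ f) :
    Differentiable ℂ (_root_.deriv f) := fun z => (hf.analyticAt z).deriv.differentiableAt

theorem Differentiable.cderivSub {f : ℂ → ℂ} (hf : Differentiable ℂ f) (t : ℝ) :
    Differentiable ℂ (cderivSub t f) :=
  hf.deriv_complex.sub (hf.const_mul _)

theorem Differentiable.iterCderivSub {f : ℂ → ℂ} (hf : Differentiable ℂ f) (ts : List ℝ) :
    Differentiable ℂ (iterCderivSub ts f) := by
  induction ts generalizing f with
  | nil => exact hf
  | cons t ts ih => exact ih (hf.cderivSub t)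

theorem deriv_realRestrict {f : ℂ → ℂ} (hf : Differentiable ℂ f) :
    deriv (realRestrict f) = realRestrict (deriv f) :=
  funext fun x => (hf x).hasDerivAt.real_of_complex.deriv

theorem realRestrict_cderivSub {f : ℂ → ℂ} (hf : Differentiable ℂ f) (t : ℝ) :
    realRestrict (cderivSub t f) = derivSub t (realRestrict f) := by
  ext x
  simp only [derivSub, deriv_realRestrict hf]
  simp [realRestrict, cderivSub]

theorem realRestrict_iterCderivSub {f : ℂ → ℂ} (hf : Differentiable ℂ f) (ts : List ℝ) :
    realRestrict (iterCderivSub ts f) = iterDerivSub ts (realRestrict f) := by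
  induction ts generalizing f with
  | nil => rfl
  | cons t ts ih =>
    refine (ih (hf.cderivSub t)).trans ?_
    rw [realRestrict_cderivSub hf]; rfl

section Limits

variable {ι : Type*} {l : Filter ι} {F : ι → ℂ → ℂ} {f : ℂ → ℂ}

theorem TendstoLocallyUniformly.deriv_complex (h : TendstoLocallyUniformly F f l)
    (hF : ∀ i, Differentiable ℂ (F i)) :
    TendstoLocallyUniformly (fun i => deriv (F i)) (deriv f) l := by
  rw [← tendstoLocallyUniformlyOn_univ] at h ⊢
  exact h.deriv (Eventually.of_forall fun i => (hF i).differentiableOn) isOpen_univ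

theorem TendstoLocallyUniformly.differentiable_complex [l.NeBot]
    (h : TendstoLocallyUniformly F f l) (hF : ∀ i, Differentiable ℂ (F i)) :
    Differentiable ℂ f := by
  rw [← tendstoLocallyUniformlyOn_univ] at h
  rw [← differentiableOn_univ]
  exact h.differentiableOn (Eventually.of_forall fun i => (hF i).differentiableOn) isOpen_univ

theorem TendstoLocallyUniformly.const_mul_complex (h : TendstoLocallyUniformly F f l) (c : ℂ) :
    TendstoLocallyUniformly (fun i z => c * F i z) (fun z => c * f z) l :=
  (uniformContinuous_const_smul c).comp_tendstoLocallyUniformly h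

theorem TendstoLocallyUniformly.iterCderivSub (h : TendstoLocallyUniformly F f l)
    (hF : ∀ i, Differentiable ℂ (F i)) (ts : List ℝ) :
    TendstoLocallyUniformly (fun i => iterCderivSub ts (F i)) (iterCderivSub ts f) l := by
  induction ts generalizing F f with
  | nil => exact h
  | cons t ts ih =>
    refine ih (F := fun i => cderivSub t (F i)) (f := cderivSub t f) ?_ fun i => (hF i).cderivSub t
    exact (h.deriv_complex hF).sub (h.const_mul_complex t)

theorem TendstoLocallyUniformly.tendsto_apply (h : TendstoLocallyUniformly F f l) (z : ℂ) :
    Tendsto (fun i => F i z) l (𝓝 (f z)) := by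
  rw [← tendstoLocallyUniformlyOn_univ] at h
  exact h.tendsto_at (mem_univ z)

theorem tendsto_laguerreExpr_realRestrict [l.NeBot] (h : TendstoLocallyUniformly F f l)
    (hF : ∀ i, Differentiable ℂ (F i)) (x : ℝ) :
    Tendsto (fun i => laguerreExpr (realRestrict (F i)) x) l (𝓝 (laguerreExpr (realRestrict f) x)) := by
  have hf := h.differentiable_complex hF
  have key : ∀ {g : ℂ → ℂ}, Differentiable ℂ g → laguerreExpr (realRestrict g) x =
      (g x).re * (deriv (deriv g) x).re - (deriv g x).re ^ 2 := fun hg => by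
    rw [laguerreExpr, deriv_realRestrict hg, deriv_realRestrict hg.deriv_complex]; rfl
  have hre : ∀ {G : ι → ℂ → ℂ} {g : ℂ → ℂ}, TendstoLocallyUniformly G g l →
      Tendsto (fun i => (G i x).re) l (𝓝 (g x).re) := fun hG =>
    (Complex.continuous_re.tendsto _).comp (hG.tendsto_apply x)
  simp only [key hf, key (hF _)]
  have h' := h.deriv_complex hF
  exact ((hre h).mul (hre (h'.deriv_complex fun i => (hF i).deriv_complex))).sub ((hre h').pow 2)

theorem eventually_realRestrict_ne_zero [l.NeBot] (h : TendstoLocallyUniformly F f l)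
    (hF : ∀ i, Differentiable ℂ (F i)) {K : Set ℝ} (hK : IsCompact K)
    (h0 : ∀ x ∈ K, realRestrict f x ≠ 0) : ∀ᶠ i in l, ∀ x ∈ K, realRestrict (F i) x ≠ 0 := by
  have hcont : Continuous (realRestrict f) := Complex.continuous_re.comp
    ((h.differentiable_complex hF).continuous.comp Complex.continuous_ofReal)
  rcases K.eq_empty_or_nonempty with rfl | hne
  · simp
  obtain ⟨c, hc, hmin⟩ := hK.exists_isMinOn hne (f := fun x => |realRestrict f x|)
    hcont.abs.continuousOn
  have hu := (tendstoLocallyUniformly_iff_forall_isCompact.1 h) _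
    (hK.image Complex.continuous_ofReal)
  filter_upwards [(Metric.tendstoUniformlyOn_iff.1 hu) _ (abs_pos.2 (h0 c hc))] with i hi x hx h1
  have h2 := hi x (mem_image_of_mem _ hx)
  have h3 : |realRestrict f c| ≤ |realRestrict f x| := hmin hx
  have h4 : |realRestrict f x - realRestrict (F i) x| ≤ dist (f x) (F i x) := by
    rw [Complex.dist_eq, realRestrict, realRestrict, ← Complex.sub_re]
    exact Complex.abs_re_le_norm _
  rw [h1, sub_zero] at h4
  linarith

/-- Nonvanishing on a compact interval and a strict inequality are open conditions, and locally
uniform convergence of entire functions passes to derivatives. -/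
theorem eventually_hasSignChanges [l.NeBot] (h : TendstoLocallyUniformly F f l)
    (hF : ∀ i, Differentiable ℂ (F i)) {N : ℕ} (hN : HasSignChanges (realRestrict f) N) :
    ∀ᶠ i in l, HasSignChanges (realRestrict (F i)) N := by
  obtain ⟨X, η, hcard, hsep, hX⟩ := hN
  have : ∀ᶠ i in l, ∀ x ∈ X, (∀ y ∈ Icc x (x + η), realRestrict (F i) y ≠ 0) ∧
      ∃ a ∈ Icc x (x + η), ∃ b ∈ Icc x (x + η),
        laguerreExpr (realRestrict (F i)) a * laguerreExpr (realRestrict (F i)) b < 0 := by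
    refine (Filter.eventually_all_finset X).2 fun x hx => ?_
    obtain ⟨h1, a, ha, b, hb, hab⟩ := hX x hx
    filter_upwards [eventually_realRestrict_ne_zero h hF isCompact_Icc h1,
      ((tendsto_laguerreExpr_realRestrict h hF a).mul
        (tendsto_laguerreExpr_realRestrict h hF b)).eventually_lt_const hab] with i h2 h3
    exact ⟨h2, a, ha, b, hb, h3⟩
  exact this.mono fun i hi => ⟨X, η, hcard, hsep, hi⟩

/-- A bound for the number of sign changes of the Laguerre expressions of all functions obtained
from `f` by operators `D - t` with `t > 0`. -/
def SignChangeBound (m : ℕ) (f : ℂ → ℂ) : Prop :=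
  ∀ ts : List ℝ, (∀ t ∈ ts, 0 < t) → ∀ N, HasSignChanges (iterDerivSub ts (realRestrict f)) N → N ≤ m

/-- The operators are chosen for the limit and not for its approximants, hence the quantification
over all lists in `SignChangeBound`. -/
theorem SignChangeBound.of_tendstoLocallyUniformly [l.NeBot] {m : ℕ}
    (h : TendstoLocallyUniformly F f l) (hF : ∀ i, Differentiable ℂ (F i))
    (hb : ∀ i, SignChangeBound m (F i)) : SignChangeBound m f := by
  intro ts hts N hN
  rw [← realRestrict_iterCderivSub (h.differentiable_complex hF)] at hN
  obtain ⟨i, hi⟩ := (eventually_hasSignChanges (h.iterCderivSub hF ts)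
    (fun i => (hF i).iterCderivSub ts) hN).exists
  rw [realRestrict_iterCderivSub (hF i)] at hi
  exact hb i ts hts N hi

end Limits

/-! ### Approximation by polynomials with few nonreal zeros -/

theorem realRestrict_aeval (p : ℝ[X]) : realRestrict (fun z => aeval z p) = fun x => p.eval x := by
  ext x
  have : aeval (x : ℂ) p = ((p.eval x : ℝ) : ℂ) := by
    simpa using (Polynomial.aeval_algebraMap_apply ℂ x p)
  simp [realRestrict, this]

theorem signChangeBound_aeval {p : ℝ[X]} {m : ℕ}
    (hp : p.natDegree ≤ m + Multiset.card p.roots) : SignChangeBound m (fun z => aeval z p) := by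
  intro ts hts N hN
  rw [realRestrict_aeval] at hN
  exact le_of_hasSignChanges_iterDerivSub_eval hp hts hN

/-- Factor aⁿ - bⁿ with a = 1 + w/n and b = e^{w/n}: both have norm at most e^{‖w‖/n}, and they
differ by at most (‖w‖/n)². -/
theorem norm_one_add_div_pow_sub_exp_le {w : ℂ} {n : ℕ} (hn : 1 ≤ n) (hw : ‖w‖ ≤ n) :
    ‖(1 + w / n) ^ n - Complex.exp w‖ ≤ ‖w‖ ^ 2 * Real.exp ‖w‖ / n := by
  have hn0 : (0 : ℝ) < n := by exact_mod_cast hn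
  have hnC : (n : ℂ) ≠ 0 := by exact_mod_cast hn0.ne'
  have hv : ‖w / n‖ = ‖w‖ / n := by simp
  have hexp : Complex.exp w = Complex.exp (w / n) ^ n := by
    rw [← Complex.exp_nat_mul, mul_div_cancel₀ _ hnC]
  have h1 : ‖(1 + w / n) - Complex.exp (w / n)‖ ≤ (‖w‖ / n) ^ 2 := by
    rw [← hv, norm_sub_rev, ← sub_sub]
    exact Complex.norm_exp_sub_one_sub_id_le (by rw [hv]; exact (div_le_one hn0).2 hw)
  have ha : ‖1 + w / n‖ ≤ Real.exp (‖w‖ / n) := by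
    refine (norm_add_le _ _).trans ?_
    rw [norm_one, hv, add_comm]; exact Real.add_one_le_exp _
  have hb : ‖Complex.exp (w / n)‖ ≤ Real.exp (‖w‖ / n) := by
    rw [← hv]; exact Complex.norm_exp_le_exp_norm _
  have hsum : ‖∑ i ∈ Finset.range n, (1 + w / n) ^ i * Complex.exp (w / n) ^ (n - 1 - i)‖
      ≤ n * Real.exp ‖w‖ := by
    have hterm : ∀ i ∈ Finset.range n,
        ‖(1 + w / n) ^ i * Complex.exp (w / n) ^ (n - 1 - i)‖ ≤ Real.exp ‖w‖ := by
      intro i hi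
      have hi' := Finset.mem_range.1 hi
      rw [norm_mul, norm_pow, norm_pow]
      calc _ ≤ Real.exp (‖w‖ / n) ^ i * Real.exp (‖w‖ / n) ^ (n - 1 - i) := by gcongr
        _ = Real.exp (‖w‖ / n) ^ (n - 1) := by rw [← pow_add]; congr 1; omega
        _ ≤ Real.exp (‖w‖ / n) ^ n :=
          pow_le_pow_right₀ (Real.one_le_exp (by positivity)) (Nat.sub_le _ _)
        _ = Real.exp ‖w‖ := by rw [← Real.exp_nat_mul, mul_div_cancel₀ _ hn0.ne']
    simpa using norm_sum_le_of_le _ hterm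
  rw [hexp, ← geom_sum₂_mul, norm_mul]
  calc _ ≤ (n * Real.exp ‖w‖) * (‖w‖ / n) ^ 2 := by gcongr
    _ = _ := by field_simp

theorem tendstoLocallyUniformly_one_add_div_pow {q : ℂ → ℂ} (hq : Continuous q) :
    TendstoLocallyUniformly (fun (n : ℕ) z => (1 + q z / (n + 1 : ℕ)) ^ (n + 1))
      (fun z => Complex.exp (q z)) atTop := by
  rw [tendstoLocallyUniformly_iff_forall_isCompact]
  intro K hK
  obtain ⟨C, hC⟩ := hK.exists_bound_of_continuousOn hq.continuousOn
  rw [Metric.tendstoUniformlyOn_iff]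
  intro ε hε
  have hlim : Tendsto (fun n : ℕ => C ^ 2 * Real.exp C / ((n + 1 : ℕ) : ℝ)) atTop (𝓝 0) :=
    (tendsto_const_div_atTop_nhds_zero_nat (C ^ 2 * Real.exp C)).comp (tendsto_add_atTop_nat 1)
  filter_upwards [hlim.eventually_lt_const hε, eventually_ge_atTop ⌈C⌉₊] with n h1 h2 z hz
  have h3 : C ≤ ((n + 1 : ℕ) : ℝ) := by
    have := Nat.ceil_le.1 h2
    push_cast; linarith
  have h4 := hC z hz
  have h5 := norm_one_add_div_pow_sub_exp_le (Nat.le_add_left 1 n) (h4.trans h3)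
  rw [dist_comm, Complex.dist_eq]
  refine (h5.trans ?_).trans_lt h1
  gcongr

theorem tendstoLocallyUniformly_const {ι : Type*} (l : Filter ι) (g : ℂ → ℂ) :
    TendstoLocallyUniformly (fun _ : ι => g) g l := fun _ hu _ =>
  ⟨univ, univ_mem, Eventually.of_forall fun _ _ _ => refl_mem_uniformity hu⟩

theorem signChangeBound_aeval_mul_exp {p q : ℝ[X]} (hq : q.Splits) {γ : ℝ} (hγ : 0 ≤ γ) (b : ℝ) :
    SignChangeBound p.natDegree (fun z => aeval z (p * q) *
      (Complex.exp (-(γ : ℂ) * z ^ 2) * Complex.exp ((b : ℂ) * z))) := by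
  -- As γ ≥ 0, the factor 1 - γz²/n splits over the reals into 1 ∓ √(γ/n) z, so the approximants to
  -- the exponentials add no nonreal zeros.
  set s : ℕ → ℝ[X] := fun n => (1 - C √(γ / (n + 1 : ℕ)) * X) ^ (n + 1) *
    (1 + C √(γ / (n + 1 : ℕ)) * X) ^ (n + 1) * (1 + C (b / (n + 1 : ℕ)) * X) ^ (n + 1) with hs
  have hlin : ∀ a : ℝ, (1 + C a * X : ℝ[X]).Splits := fun a =>
    Splits.of_natDegree_le_one (by compute_degree)
  have hssplit : ∀ n, (s n).Splits := fun n => by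
    have : (1 - C √(γ / (n + 1 : ℕ)) * X : ℝ[X]) = 1 + C (-√(γ / (n + 1 : ℕ))) * X := by
      simp [sub_eq_add_neg]
    rw [hs]
    simp only [this]
    exact (((hlin _).pow _).mul ((hlin _).pow _)).mul ((hlin _).pow _)
  have hseval : ∀ n z, aeval z (s n) = (1 + (-(γ : ℂ) * z ^ 2) / (n + 1 : ℕ)) ^ (n + 1) *
      (1 + ((b : ℂ) * z) / (n + 1 : ℕ)) ^ (n + 1) := by
    intro n z
    have h1 : ((√(γ / (n + 1 : ℕ)) : ℝ) : ℂ) * ((√(γ / (n + 1 : ℕ)) : ℝ) : ℂ)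
        = (γ : ℂ) / (n + 1 : ℕ) := by
      rw [← Complex.ofReal_mul, Real.mul_self_sqrt (by positivity)]; push_cast; rfl
    simp only [hs, map_mul, map_pow, map_sub, map_add, map_one, aeval_C, aeval_X,
      Complex.coe_algebraMap]
    rw [← mul_pow]
    congr 2
    · linear_combination (-z ^ 2) * h1
    · push_cast; ring
  have hdeg : ∀ n, (p * q * s n).natDegree ≤ p.natDegree + Multiset.card (p * q * s n).roots := by
    intro n
    rw [mul_assoc]
    rcases eq_or_ne (p * (q * s n)) 0 with h0 | h0
    · simp [h0]
    rw [roots_mul h0, Multiset.card_add, ← (hq.mul (hssplit n)).natDegree_eq_card_roots]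
    refine natDegree_mul_le.trans ?_
    omega
  refine SignChangeBound.of_tendstoLocallyUniformly (l := atTop)
    (F := fun (n : ℕ) z => aeval z (p * q * s n)) ?_ (fun n => Polynomial.differentiable_aeval _)
    (fun n => signChangeBound_aeval (hdeg n))
  simp only [map_mul _ (p * q), hseval]
  have c1 : Continuous fun z : ℂ => -(γ : ℂ) * z ^ 2 := by fun_prop
  have c2 : Continuous fun z : ℂ => (b : ℂ) * z := by fun_prop
  exact (tendstoLocallyUniformly_const atTop fun z => aeval z (p * q)).fun_mul₀
    ((tendstoLocallyUniformly_one_add_div_pow c1).fun_mul₀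
      (tendstoLocallyUniformly_one_add_div_pow c2) (by fun_prop) (by fun_prop))
    (Polynomial.continuous_aeval _) (by fun_prop)

theorem norm_one_sub_mul_exp_sub_one_le {w : ℂ} (hw : ‖w‖ ≤ 1) :
    ‖(1 - w) * Complex.exp w - 1‖ ≤ 3 * ‖w‖ ^ 2 := by
  have h1 := Complex.norm_exp_sub_one_sub_id_le hw
  have h2 := Complex.norm_exp_sub_one_le hw
  have : (1 - w) * Complex.exp w - 1 = (Complex.exp w - 1 - w) - w * (Complex.exp w - 1) := by ring
  rw [this]
  refine (norm_sub_le _ _).trans ?_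
  rw [norm_mul]
  nlinarith [norm_nonneg w]

/-- The genus one canonical product with real zeros converges locally uniformly. -/
theorem tendstoLocallyUniformly_canonicalProduct {J : Type*} {α : J → ℝ}
    (hsum : Summable fun j => (α j ^ 2)⁻¹) {P : ℂ → ℂ}
    (hP : ∀ z : ℂ, HasProd (fun j => (1 - z / (α j : ℂ)) * Complex.exp (z / (α j : ℂ))) (P z)) :
    TendstoLocallyUniformly (fun (S : Finset J) z =>
      ∏ j ∈ S, ((1 - z / (α j : ℂ)) * Complex.exp (z / (α j : ℂ)))) P atTop := by
  rw [tendstoLocallyUniformly_iff_forall_isCompact]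
  intro K hK
  obtain ⟨R, hR⟩ := hK.exists_bound_of_continuousOn continuousOn_id
  -- (1 - w)e^w - 1 = O(w²), and all but finitely many j have |z/α_j| ≤ 1 on K; this yields the
  -- majorant for the M-test.
  have hev : ∀ᶠ j in cofinite, ∀ z ∈ K,
      ‖(1 - z / (α j : ℂ)) * Complex.exp (z / (α j : ℂ)) - 1‖ ≤ 3 * (R ^ 2 * (α j ^ 2)⁻¹) := by
    have h1 : Tendsto (fun j => R ^ 2 * (α j ^ 2)⁻¹) cofinite (𝓝 0) := by
      simpa using hsum.tendsto_cofinite_zero.const_mul (R ^ 2)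
    filter_upwards [h1.eventually_lt_const one_pos] with j hj z hz
    have h2 : ‖z‖ ≤ R := hR z hz
    have h3 : ‖z / (α j : ℂ)‖ ^ 2 ≤ R ^ 2 * (α j ^ 2)⁻¹ := by
      rw [norm_div, Complex.norm_real, div_pow, Real.norm_eq_abs, sq_abs, div_eq_mul_inv]
      gcongr
    have h4 : ‖z / (α j : ℂ)‖ ≤ 1 := by
      by_contra hcon
      nlinarith [not_le.1 hcon]
    exact (norm_one_sub_mul_exp_sub_one_le h4).trans (by linarith)
  have hprod := Summable.hasProdUniformlyOn_one_add hK
    (f := fun j z => (1 - z / (α j : ℂ)) * Complex.exp (z / (α j : ℂ)) - 1)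
    ((hsum.mul_left (R ^ 2)).mul_left 3) hev (fun j => by fun_prop)
  simp only [add_sub_cancel] at hprod
  refine (hprod.tendstoUniformlyOn.congr_right fun z hz => ?_)
  exact (hP z).tprod_eq

/-- Functions in the Laguerre–Pólya class are entire and real on the real axis, and their products
with a real polynomial `p` satisfy the sign change bound given by the degree of `p`. -/
theorem IsLaguerrePolya.mul_aeval {f : ℂ → ℂ} (hf : IsLaguerrePolya f) (p : ℝ[X]) :
    Differentiable ℂ f ∧ (∀ x : ℝ, (f x).im = 0) ∧
      SignChangeBound p.natDegree (fun z => aeval z p * f z) := by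
  obtain ⟨c, β, γ, d, ω, α, hγ, -, hsum, hprod⟩ := hf
  choose P hP hfP using hprod
  have hlim := tendstoLocallyUniformly_canonicalProduct
    (J := {j : ℕ // (j : ℕ∞) < ω}) (α := fun j => α j) hsum hP
  have hdiff : ∀ S : Finset {j : ℕ // (j : ℕ∞) < ω}, Differentiable ℂ (fun z =>
      ∏ j ∈ S, ((1 - z / (α j : ℂ)) * Complex.exp (z / (α j : ℂ)))) := fun S => by fun_prop
  have hPd : Differentiable ℂ P := hlim.differentiable_complex hdiff
  have hfeq : f = fun z => (c : ℂ) * z ^ d * Complex.exp (-(γ : ℂ) * z ^ 2 + (β : ℂ) * z) * P z :=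
    funext hfP
  refine ⟨by rw [hfeq]; fun_prop, ?_, ?_⟩
  · have hstar : ∀ x : ℝ, (starRingEnd ℂ) (P x) = P x := by
      intro x
      refine ((hP x).map (starRingEnd ℂ) Complex.continuous_conj).unique ?_
      convert! hP x using 2 with j
      simp [← Complex.exp_conj]
    intro x
    rw [← Complex.conj_eq_iff_im, hfP, map_mul, hstar]
    simp [← Complex.exp_conj]
  · refine SignChangeBound.of_tendstoLocallyUniformly (l := atTop)
      (F := fun (S : Finset {j : ℕ // (j : ℕ∞) < ω}) z => (aeval z p * ((c : ℂ) * z ^ d *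
        Complex.exp (-(γ : ℂ) * z ^ 2 + (β : ℂ) * z))) *
        ∏ j ∈ S, ((1 - z / (α j : ℂ)) * Complex.exp (z / (α j : ℂ)))) ?_ ?_ ?_
    · have h1 : (fun z => aeval z p * f z) = fun z => (aeval z p * ((c : ℂ) * z ^ d *
          Complex.exp (-(γ : ℂ) * z ^ 2 + (β : ℂ) * z))) * P z := by
        ext z; rw [hfP]; ring
      rw [h1]
      have h2 : Continuous fun z : ℂ => aeval z p * ((c : ℂ) * z ^ d *
          Complex.exp (-(γ : ℂ) * z ^ 2 + (β : ℂ) * z)) := by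
        have := Polynomial.continuous_aeval (A := ℂ) p
        fun_prop
      exact (tendstoLocallyUniformly_const atTop _).fun_mul₀ hlim h2 hPd.continuous
    · intro S
      have := Polynomial.differentiable_aeval (𝕜 := ℂ) p
      fun_prop
    · intro S
      set q : ℝ[X] := C c * X ^ d * ∏ j ∈ S, (1 - C (α j)⁻¹ * X) with hq
      have hqs : q.Splits := by
        refine ((Splits.C c).mul (Splits.X_pow d)).mul (Splits.prod fun j _ => ?_)
        exact Splits.of_natDegree_le_one (by compute_degree)
      -- For a finite product the factors e^{z/α_j} merge with e^{βz}.
      have := signChangeBound_aeval_mul_exp (p := p) hqs hγ (β + ∑ j ∈ S, (α j)⁻¹)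
      convert this using 2 with z
      have h1 : aeval z q = (c : ℂ) * z ^ d * ∏ j ∈ S, (1 - z / (α j : ℂ)) := by
        simp only [hq, map_mul, map_prod, map_sub, map_one, map_pow, aeval_C, aeval_X,
          Complex.coe_algebraMap]
        congr 1
        refine Finset.prod_congr rfl fun j _ => ?_
        push_cast; ring
      rw [map_mul, h1, Finset.prod_mul_distrib, ← Complex.exp_sum, Complex.exp_add]
      have h2 : Complex.exp (((β + ∑ j ∈ S, (α j)⁻¹ : ℝ) : ℂ) * z) =
          Complex.exp ((β : ℂ) * z) * Complex.exp (∑ j ∈ S, z / (α j : ℂ)) := by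
        rw [← Complex.exp_add]
        congr 1
        push_cast
        rw [add_mul, Finset.sum_mul]
        congr 1
        exact Finset.sum_congr rfl fun j _ => by ring
      rw [h2]
      ring

/-! ### Orders of zeros of Q, the exceptional exponentials, and the theorem -/

theorem AnalyticAt.realRestrict {f : ℂ → ℂ} {x : ℝ} (hf : AnalyticAt ℂ f x) :
    AnalyticAt ℝ (realRestrict f) x :=
  (Complex.reCLM.analyticAt _).comp
    ((hf.restrictScalars (𝕜 := ℝ)).comp_of_eq (Complex.ofRealCLM.analyticAt x) rfl)

theorem analyticOnNhd_realRestrict {f : ℂ → ℂ} (hf : Differentiable ℂ f) :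
    AnalyticOnNhd ℝ (realRestrict f) univ := fun x _ => (hf.analyticAt x).realRestrict

theorem im_deriv_eq_zero {f : ℂ → ℂ} (hf : Differentiable ℂ f) (hreal : ∀ x : ℝ, (f x).im = 0)
    (x : ℝ) : (deriv f x).im = 0 := by
  have h1 := ((hf x).hasDerivAt.const_mul (-Complex.I)).real_of_complex
  have h2 : (fun y : ℝ => (-Complex.I * f y).re) = fun _ => 0 := by
    ext y; simp [hreal y]
  rw [h2] at h1
  simpa using h1.unique (hasDerivAt_const x (0 : ℝ))

theorem ofReal_realRestrict {f : ℂ → ℂ} (hreal : ∀ x : ℝ, (f x).im = 0) (x : ℝ) :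
    ((realRestrict f x : ℝ) : ℂ) = f x :=
  Complex.ext (by simp [realRestrict]) (by simp [hreal x])

theorem eq_zero_of_eventually_ofReal {f : ℂ → ℂ} (hf : Differentiable ℂ f) {x : ℝ}
    (h : ∀ᶠ y : ℝ in 𝓝 x, f y = 0) : f = 0 := by
  refine AnalyticOnNhd.eq_of_frequently_eq (z₀ := (x : ℂ)) (fun z _ => hf.analyticAt z)
    (fun z _ => analyticAt_const) ?_
  have htend : Tendsto (fun y : ℝ => (y : ℂ)) (𝓝[≠] x) (𝓝[≠] (x : ℂ)) :=
    tendsto_nhdsWithin_of_tendsto_nhds_of_eventually_within _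
      ((Complex.continuous_ofReal.tendsto x).mono_left nhdsWithin_le_nhds)
      (by filter_upwards [self_mem_nhdsWithin] with y hy using by simpa using hy)
  exact htend.frequently (h.filter_mono nhdsWithin_le_nhds).frequently

/-- The Laguerre expression vanishes identically only for exponential functions. -/
theorem exists_eq_exp_of_analyticOrderAt_laguerreExpr_eq_top {f : ℂ → ℂ} (hf : Differentiable ℂ f)
    (hreal : ∀ x : ℝ, (f x).im = 0) {x : ℝ}
    (h : analyticOrderAt (laguerreExpr (realRestrict f)) x = ⊤) :
    ∃ C β : ℝ, ∀ z : ℂ, f z = (C : ℂ) * Complex.exp ((β : ℂ) * z) := by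
  set r := realRestrict f with hr
  have hra := analyticOnNhd_realRestrict hf
  by_cases h0 : ∀ y, r y = 0
  · have : f = 0 := eq_zero_of_eventually_ofReal hf (x := 0) (Eventually.of_forall fun y => by
      rw [← ofReal_realRestrict hreal, ← hr, h0 y, Complex.ofReal_zero])
    exact ⟨0, 0, fun z => by simp [this]⟩
  push Not at h0
  obtain ⟨x₀, hx₀⟩ := h0
  have hW : laguerreExpr r = 0 := hra.laguerreExpr.eq_of_eventuallyEq
    (fun _ _ => analyticAt_const) (analyticOrderAt_eq_top.1 h)
  have hne : ∀ᶠ y in 𝓝 x₀, r y ≠ 0 := (hra x₀ (mem_univ _)).continuousAt.eventually_ne hx₀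
  obtain ⟨ε, hε, hball⟩ := Metric.eventually_nhds_iff_ball.1 hne
  set β := deriv r x₀ / r x₀ with hβ
  have hconst : ∀ y ∈ Metric.ball x₀ ε, deriv r y / r y = β := by
    intro y hy
    have hd : ∀ z ∈ Metric.ball x₀ ε, HasDerivAt (fun z => deriv r z / r z) 0 z := by
      intro z hz
      refine ((hra.deriv.hasDerivAt_of_univ z).div (hra.hasDerivAt_of_univ z)
        (hball z hz)).congr_deriv ?_
      have : laguerreExpr r z = 0 := by rw [hW]; rfl
      rw [laguerreExpr] at this
      rw [div_eq_zero_iff]; left; linarith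
    exact (convex_ball x₀ ε).is_const_of_fderivWithin_eq_zero (𝕜 := ℝ)
      (fun z hz => (hd z hz).differentiableAt.differentiableWithinAt)
      (fun z hz => by
        rw [fderivWithin_of_isOpen Metric.isOpen_ball hz]
        ext; simpa using (hd z hz).deriv) hy (Metric.mem_ball_self hε)
  -- On an interval r'/r is the constant β; the identity theorem extends f' = βf to the whole plane.
  have hode : ∀ z, deriv f z = (β : ℂ) * f z := by
    have hg : Differentiable ℂ (fun z => deriv f z - (β : ℂ) * f z) :=
      hf.deriv_complex.sub (hf.const_mul _)
    have := eq_zero_of_eventually_ofReal hg (x := x₀) (by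
      filter_upwards [Metric.ball_mem_nhds x₀ hε] with y hy
      have h1 := hconst y hy
      rw [div_eq_iff (hball y hy)] at h1
      rw [← ofReal_realRestrict hreal, ← ofReal_realRestrict (im_deriv_eq_zero hf hreal),
        ← deriv_realRestrict hf, ← hr, h1]
      push_cast; ring)
    exact fun z => sub_eq_zero.1 (congrFun this z)
  have hexp : ∀ z, HasDerivAt (fun z => f z * Complex.exp (-(β : ℂ) * z)) 0 z := by
    intro z
    have h1 : HasDerivAt (fun z : ℂ => Complex.exp (-(β : ℂ) * z))
        (Complex.exp (-(β : ℂ) * z) * (-(β : ℂ))) z := by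
      simpa using ((hasDerivAt_id z).const_mul (-(β : ℂ))).cexp
    refine ((hf z).hasDerivAt.mul h1).congr_deriv ?_
    rw [hode]; ring
  refine ⟨r 0, β, fun z => ?_⟩
  have h2 := is_const_of_deriv_eq_zero (fun z => (hexp z).differentiableAt)
    (fun z => (hexp z).deriv) z 0
  simp only [mul_zero, Complex.exp_zero, mul_one] at h2
  have h3 := ofReal_realRestrict hreal 0
  rw [Complex.ofReal_zero, ← hr] at h3
  rw [h3, ← h2, mul_assoc, ← Complex.exp_add]
  simp

theorem AnalyticAt.zeroMultiplicity_eq {f : ℂ → ℂ} {z : ℂ} (hf : AnalyticAt ℂ f z) :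
    zeroMultiplicity f z = analyticOrderAt f z := by
  rw [zeroMultiplicity, hf.meromorphicOrderAt_eq]
  cases analyticOrderAt f z <;> rfl

/-- f'/f has a simple pole there, so its derivative has order -2, which truncates to 0. -/
theorem zeroMultiplicity_hawaiiQ_of_eq_zero {f : ℂ → ℂ} {z : ℂ} (hf : Differentiable ℂ f)
    (hz : f z = 0) (htop : analyticOrderAt f z ≠ ⊤) : zeroMultiplicity (hawaiiQ f) z = 0 := by
  have hfa := hf.analyticAt z
  have h0 : analyticOrderAt f z ≠ 0 := hfa.analyticOrderAt_ne_zero.2 hz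
  have h1 : meromorphicOrderAt (fun w => deriv f w / f w) z = ((-1 : ℤ) : WithTop ℤ) := by
    have := meromorphicOrderAt_logDeriv_eq_neg_one hfa.meromorphicAt
      (by rw [hfa.meromorphicOrderAt_eq]
          cases h : analyticOrderAt f z with
          | top => simp
          | coe n =>
            rw [h] at h0
            simpa using h0)
      (by rw [hfa.meromorphicOrderAt_eq]; simpa using htop)
    exact this
  have h2 := meromorphicOrderAt_deriv_eq_sub_one (by norm_num) h1
  rw [zeroMultiplicity, hawaiiQ, h2]
  rfl

/-- At a real point which is not a pole, the multiplicity of a zero of `(f' / f)'` is at most the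
order of the Laguerre expression. -/
theorem zeroMultiplicity_hawaiiQ_le {f : ℂ → ℂ} (hf : Differentiable ℂ f)
    (hreal : ∀ x : ℝ, (f x).im = 0) {x : ℝ} (hx : f x ≠ 0) :
    zeroMultiplicity (hawaiiQ f) x ≤ analyticOrderAt (laguerreExpr (realRestrict f)) x := by
  have hQ : AnalyticAt ℂ (hawaiiQ f) x :=
    ((hf.analyticAt x).deriv.div (hf.analyticAt x) hx).deriv
  rw [hQ.zeroMultiplicity_eq]
  refine ENat.forall_natCast_le_iff_le.1 fun n hn => ?_
  obtain ⟨g, hg, hgQ⟩ := (natCast_le_analyticOrderAt hQ).1 hn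
  have hra := analyticOnNhd_realRestrict hf
  refine (natCast_le_analyticOrderAt (hra.laguerreExpr x (mem_univ x))).2
    ⟨fun y => realRestrict f y ^ 2 * realRestrict g y,
      ((hra x (mem_univ x)).pow 2).mul hg.realRestrict, ?_⟩
  have hne : ∀ᶠ y : ℝ in 𝓝 x, f y ≠ 0 := Complex.continuous_ofReal.continuousAt.eventually
    (hf.continuous.continuousAt.eventually_ne hx)
  filter_upwards [Complex.continuous_ofReal.continuousAt.eventually hgQ, hne] with y hy hy0
  have h1 : hawaiiQ f y = (deriv (deriv f) y * f y - deriv f y * deriv f y) / f y ^ 2 :=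
    ((hf.deriv_complex y).hasDerivAt.div (hf y).hasDerivAt hy0).deriv
  have hreal' := im_deriv_eq_zero hf hreal
  have hreal'' := im_deriv_eq_zero hf.deriv_complex hreal'
  -- L[f] = f²Q on the real axis, so a factor (z - x)^n of Q restricts to a factor of L[f].
  have h2 : ((laguerreExpr (realRestrict f) y : ℝ) : ℂ) = f y ^ 2 * hawaiiQ f y := by
    rw [laguerreExpr, deriv_realRestrict hf, deriv_realRestrict hf.deriv_complex]
    push_cast
    rw [ofReal_realRestrict hreal, ofReal_realRestrict hreal', ofReal_realRestrict hreal'', h1]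
    field_simp
  have h3 : ((y - x : ℝ) : ℂ) = (y : ℂ) - x := by push_cast; rfl
  rw [hy, ← ofReal_realRestrict hreal, ← h3, ← Complex.ofReal_pow, ← Complex.ofReal_pow,
    smul_eq_mul] at h2
  have h4 := congrArg Complex.re h2
  rw [Complex.ofReal_re, Complex.re_ofReal_mul, Complex.re_ofReal_mul] at h4
  rw [h4, smul_eq_mul]
  simp only [realRestrict]; ring

/-- All complex roots of p are nonreal, and the product with f vanishes there to at least the same
order. -/
theorem natDegree_le_of_zeroCount {p : ℝ[X]} (hp : ∀ x : ℝ, p.eval x ≠ 0) {f : ℂ → ℂ}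
    (hf : Differentiable ℂ f) :
    (p.natDegree : ℕ∞) ≤ zeroCount (fun z => aeval z p * f z) {z : ℂ | z.im ≠ 0} := by
  have hp0 : p ≠ 0 := by rintro rfl; exact hp 0 (by simp)
  set q := p.map (algebraMap ℝ ℂ) with hq
  have hq0 : q ≠ 0 := (Polynomial.map_ne_zero_iff (algebraMap ℝ ℂ).injective).2 hp0
  have hroots : ∀ z ∈ q.roots.toFinset, z.im ≠ 0 := by
    intro z hz him
    rw [Multiset.mem_toFinset, mem_roots hq0, IsRoot.def, hq, eval_map_algebraMap] at hz
    have : z = ((z.re : ℝ) : ℂ) := Complex.ext rfl (by simpa using him)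
    rw [this] at hz
    refine hp z.re ?_
    have h2 : aeval ((z.re : ℝ) : ℂ) p = ((p.eval z.re : ℝ) : ℂ) := by
      simpa using (Polynomial.aeval_algebraMap_apply ℂ z.re p)
    rw [h2] at hz
    exact_mod_cast hz
  refine le_trans ?_ (le_iSup (fun F : {F : Finset ℂ // (F : Set ℂ) ⊆ {z : ℂ | z.im ≠ 0}} =>
    ∑ z ∈ F.1, zeroMultiplicity (fun z => aeval z p * f z) z)
    ⟨q.roots.toFinset, fun z hz => hroots z (by simpa using hz)⟩)
  have hdeg : p.natDegree = ∑ z ∈ q.roots.toFinset, q.roots.count z := by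
    rw [Multiset.toFinset_sum_count_eq, ← (IsAlgClosed.splits q).natDegree_eq_card_roots, hq,
      natDegree_map]
  rw [hdeg, Nat.cast_sum]
  refine Finset.sum_le_sum fun z _ => ?_
  have hd : Differentiable ℂ (fun z => aeval z p * f z) :=
    (Polynomial.differentiable_aeval p).mul hf
  rw [(hd.analyticAt z).zeroMultiplicity_eq, count_roots,
    natCast_le_analyticOrderAt (hd.analyticAt z)]
  obtain ⟨s, hs⟩ := q.pow_rootMultiplicity_dvd z
  refine ⟨fun w => s.eval w * f w, (s.differentiable.mul hf).analyticAt z,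
    Eventually.of_forall fun w => ?_⟩
  have h1 : aeval w p = q.eval w := by rw [hq, eval_map_algebraMap]
  have h2 : q.eval w = (w - z) ^ q.rootMultiplicity z * s.eval w := by
    conv_lhs => rw [hs]
    simp
  rw [h1, h2, smul_eq_mul]; ring

theorem mainTheorem1 (φ : ℂ → ℂ) (hφ : IsLaguerrePolyaStar φ)
    (hexp : ¬ ∃ C β : ℝ, ∀ z : ℂ, φ z = (C : ℂ) * Complex.exp ((β : ℂ) * z))
    (m : ℕ) (hm : zeroCount φ {z : ℂ | z.im ≠ 0} = ((2 * m : ℕ) : ℕ∞)) :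
    zeroCount (hawaiiQ φ) {z : ℂ | z.im = 0} ≤ ((2 * m : ℕ) : ℕ∞) := by
  obtain ⟨p, f, hp, hf, hpf⟩ := hφ
  obtain ⟨hfd, hfreal, hbound⟩ := hf.mul_aeval p
  have hφeq : φ = fun z => aeval z p * f z := funext hpf
  rw [← hφeq] at hbound
  have hdeg : p.natDegree ≤ 2 * m := by
    have := natDegree_le_of_zeroCount hp hfd
    rw [← hφeq, hm] at this
    exact_mod_cast this
  have hφd : Differentiable ℂ φ := by
    rw [hφeq]; exact (Polynomial.differentiable_aeval p).mul hfd
  have hφreal : ∀ x : ℝ, (φ x).im = 0 := by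
    intro x
    have h2 : aeval (x : ℂ) p = ((p.eval x : ℝ) : ℂ) := by
      simpa using (Polynomial.aeval_algebraMap_apply ℂ x p)
    rw [hpf, h2, Complex.im_ofReal_mul, hfreal, mul_zero]
  set r := realRestrict φ with hr
  have hra : AnalyticOnNhd ℝ r univ := analyticOnNhd_realRestrict hφd
  have hfin : ∀ x, analyticOrderAt (laguerreExpr r) x ≠ ⊤ := fun x h =>
    hexp (exists_eq_exp_of_analyticOrderAt_laguerreExpr_eq_top hφd hφreal h)
  have hφtop : ∀ z, analyticOrderAt φ z ≠ ⊤ := by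
    intro z hz
    have : φ = 0 := AnalyticOnNhd.eq_of_eventuallyEq (fun w _ => hφd.analyticAt w)
      (fun _ _ => analyticAt_const) (analyticOrderAt_eq_top.1 hz)
    exact hexp ⟨0, 0, fun w => by simp [this]⟩
  refine iSup_le fun ⟨F, hF⟩ => ?_
  have hFre : ∀ z ∈ F, ((z.re : ℝ) : ℂ) = z := fun z hz =>
    Complex.ext rfl (by simpa using (hF hz).symm)
  -- Only zeros of L[r] that are not zeros of φ contribute to the count.
  set X : Finset ℝ := (F.image Complex.re).filter (fun x => r x ≠ 0 ∧ laguerreExpr r x = 0) with hX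
  have hle : ∑ z ∈ F, zeroMultiplicity (hawaiiQ φ) z
      ≤ ((∑ x ∈ X, analyticOrderNatAt (laguerreExpr r) x : ℕ) : ℕ∞) := by
    have h1 : ∀ z ∈ F, zeroMultiplicity (hawaiiQ φ) z ≤ if r z.re ≠ 0 ∧ laguerreExpr r z.re = 0
        then ((analyticOrderNatAt (laguerreExpr r) z.re : ℕ) : ℕ∞) else 0 := by
      intro z hz
      by_cases h0 : φ z = 0
      · rw [zeroMultiplicity_hawaiiQ_of_eq_zero hφd h0 (hφtop z)]; exact zero_le
      rw [← hFre z hz] at h0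
      have h2 := zeroMultiplicity_hawaiiQ_le hφd hφreal h0
      rw [hFre z hz] at h2
      have h3 : r z.re ≠ 0 := fun h => h0 (by
        rw [← ofReal_realRestrict hφreal, ← hr, h, Complex.ofReal_zero])
      split_ifs with h
      · rw [Nat.cast_analyticOrderNatAt (hfin _)]; exact h2
      · have h4 : laguerreExpr r z.re ≠ 0 := fun h5 => h ⟨h3, h5⟩
        rw [← (hra.laguerreExpr _ (mem_univ _)).analyticOrderAt_eq_zero] at h4
        rw [← h4]; exact h2
    have hinj : Set.InjOn Complex.re F := fun a ha b hb hab => by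
      rw [← hFre a ha, ← hFre b hb, hab]
    refine (Finset.sum_le_sum h1).trans_eq ?_
    rw [hX, Nat.cast_sum, Finset.sum_filter, Finset.sum_image hinj]
  refine hle.trans ?_
  obtain ⟨ts, hts, hsign⟩ := exists_hasSignChanges_iterDerivSub hra hfin (X := X)
    (fun x hx => (Finset.mem_filter.1 hx).2) le_rfl
  exact_mod_cast (hbound ts hts _ hsign).trans hdeg
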